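/- Consider the planar Stark problem \[ \ddot x=-\frac{x}{r^3}+1,\qquad \ddot y=-\frac{y}{r^3},\qquad r=\sqrt{x^2+y^2}. \] For $a\in(0,1)$, $v\in\mathbb R$ and an integer $k\ge 0$, consider the solution with $(x(0),y(0))=(a,0)$ and $(\dot x(0),\dot y(0))=(0,v)$. Call it an orbit of type $A_k$ if it is defined for all times (without collision), is periodic, and there is a first time $T>0$ at which it lies on the negative $x$-axis $\{x<0,\,y=0\}$; at that time it meets this axis perpendicularly ($\dot x(T)=0$, $\dot y(T)\neq 0$), and it meets the positive $x$-axis $\{x>0,\,y=0\}$ at exactly $k$ times $t\in(0,T)$. Call it an orbit of type $B_k$ if it collides with the origin at some finite time $T>0$, that is, it is a solution up to time $T$ with $(x(t),y(t))\to(0,0)$ as $t\to T^-$, and it meets the positive $x$-axis at exactly $k$ times $t\in(0,T)$. (The initial instant $t=0$ is not counted.) **Theorem.** For every $a\in(0,1)$ there are $k_p=k_p(a)\in\mathbb N$ and real numbers $b_k,b'_k$ ($k\ge k_p$) such that: (i) for every $k\ge k_p$ the solution with initial velocity $(0,b_k)$ is an orbit of type $A_k$; (ii) for every $k\ge k_p$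 the solution with initial velocity $(0,b'_k)$ is an orbit of type $B_k$; (iii) $\lim_{k\to\infty}b_k=\lim_{k\to\infty}b'_k=\sqrt{\frac2a-2a}$; (iv) $0<b_k<b'_k<b_{k+1}$ for all $k\ge k_p$. Here $k_p(a)$ can be taken minimal, in the sense that for $k<k_p(a)$ no initial velocity $(0,v)$, $v\in\mathbb R$, at $(a,0)$ gives an orbit of type $A_k$; and with this choice $\lim_{a\to1^-}k_p(a)=+\infty$. -/

import Mathlib

open Set Filter Topology

/-- `(x, y)` is a (collision-free) solution of the planar Stark problem
`x'' = -x / r ^ 3 + 1`, `y'' = -y / r ^ 3`, `r = √(x ^ 2 + y ^ 2)`, on the open set of times `I`. -/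
structure IsStarkSolutionOn (x y : ℝ → ℝ) (I : Set ℝ) : Prop where
  ne_origin : ∀ t ∈ I, ¬ (x t = 0 ∧ y t = 0)
  differentiableAt_x : ∀ t ∈ I, DifferentiableAt ℝ x t
  differentiableAt_y : ∀ t ∈ I, DifferentiableAt ℝ y t
  accel_x : ∀ t ∈ I, HasDerivAt (deriv x) (-x t / √(x t ^ 2 + y t ^ 2) ^ 3 + 1) t
  accel_y : ∀ t ∈ I, HasDerivAt (deriv y) (-y t / √(x t ^ 2 + y t ^ 2) ^ 3) t

/-- The path starts at time `0` from `(a, 0)` with velocity `(0, v)`. -/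
def StartsFrom (x y : ℝ → ℝ) (a v : ℝ) : Prop :=
  x 0 = a ∧ y 0 = 0 ∧ deriv x 0 = 0 ∧ deriv y 0 = v

/-- At time `t` the path is on the positive `x`-axis. -/
def OnPosXAxis (x y : ℝ → ℝ) (t : ℝ) : Prop := 0 < x t ∧ y t = 0

/-- At time `t` the path is on the negative `x`-axis. -/
def OnNegXAxis (x y : ℝ → ℝ) (t : ℝ) : Prop := x t < 0 ∧ y t = 0

/-- `(x, y)` is a periodic orbit from `(a, 0)` with velocity `(0, v)` that, after the initial
instant, meets the positive `x`-axis exactly `k` times before it meets the negative `x`-axis for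
the first time (at time `T`), and this meeting is perpendicular. -/
def IsOrbitA (a v : ℝ) (k : ℕ) (x y : ℝ → ℝ) : Prop :=
  IsStarkSolutionOn x y univ ∧ StartsFrom x y a v ∧
  (∃ P : ℝ, 0 < P ∧ Function.Periodic x P ∧ Function.Periodic y P) ∧
  ∃ T : ℝ, 0 < T ∧
    (∀ t ∈ Ico 0 T, ¬ OnNegXAxis x y t) ∧
    OnNegXAxis x y T ∧ deriv x T = 0 ∧ deriv y T ≠ 0 ∧
    {t ∈ Ioo 0 T | OnPosXAxis x y t}.encard = k

/-- `(x, y)` is an orbit from `(a, 0)` with velocity `(0, v)` that collides with the origin at a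
finite time `T > 0` and, after the initial instant, meets the positive `x`-axis exactly `k` times
before that collision. -/
def IsOrbitB (a v : ℝ) (k : ℕ) (x y : ℝ → ℝ) : Prop :=
  ∃ S T : ℝ, S < 0 ∧ 0 < T ∧
    IsStarkSolutionOn x y (Ioo S T) ∧ StartsFrom x y a v ∧
    Tendsto x (𝓝[<] T) (𝓝 0) ∧ Tendsto y (𝓝[<] T) (𝓝 0) ∧
    {t ∈ Ioo 0 T | OnPosXAxis x y t}.encard = k

/-! ### Incomplete elliptic integrals and their inverses -/

/-! The planar Stark problem separates in Levi-Civita coordinates x = (ξ² - η²)/2, y = ξη with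
regularized time dt = (ξ² + η²) du. An orbit leaving (a, 0) perpendicularly with v² < 2/a - 2a
becomes a pair of independent oscillators, ξ = √(2a) cos θ and η = B sin φ, whose angles are
inverses of elliptic integrals. Let K be the first positive zero of ξ and 2L the spacing of the
zeros of η. Before K the x-axis is met only on its positive half, at the zeros of η. At K the orbit
is on the negative axis, or at the origin if η vanishes too. Hence K = (2k+1)L, where η is extremal,
gives type A with k crossings, and K = 2(k+1)L gives type B (`isOrbitA_stark`, `isOrbitB_stark`).

Everything is thus read off the ratio W(v) = K/(2L): type A at the level k + 1/2, type B at k + 1. W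
is continuous and blows up as v tends to √(2/a - 2a) from below, because K diverges logarithmically
while L stays bounded (`tendsto_starkRatio`). W is not shown to be monotone; taking the last
crossing of each level gives velocities that increase with the level and converge to the critical
one (`exists_last_crossing`).

For minimality, the energy and Runge–Lenz integrals show that a type A orbit must have 0 < |v| below
the critical speed; ODE uniqueness then makes it the explicit orbit up to its first arrival on the
negative axis, so that W(|v|) = k + 1/2 (`IsOrbitA.starkK_eq`). The lower bound on W is uniform in v
and tends to infinity as a → 1 (`ratioBound_le_starkRatio`), which forces the minimal index to
infinity. -/

theorem OrderIso.hasDerivAt_symm (e : ℝ ≃o ℝ) {f' : ℝ} {y : ℝ}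
    (he : HasDerivAt e f' (e.symm y)) (hf' : f' ≠ 0) : HasDerivAt e.symm f'⁻¹ y :=
  HasDerivAt.of_local_left_inverse e.symm.continuous.continuousAt he hf'
    (Eventually.of_forall fun y => e.apply_symm_apply y)

/-- The incomplete elliptic integral `∫₀ˣ ds / √(α + β sin² s)`. -/
noncomputable def ellipticF (α β x : ℝ) : ℝ :=
  ∫ s in (0 : ℝ)..x, 1 / √(α + β * Real.sin s ^ 2)

/-- The amplitude function: the inverse of the elliptic integral. -/
noncomputable def ellipticAm (α β : ℝ) : ℝ → ℝ := Function.invFun (ellipticF α β)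

theorem ellipticF_zero (α β : ℝ) : ellipticF α β 0 = 0 := by simp [ellipticF]

section
variable {α β : ℝ}

theorem elliptic_radicand_pos (hα : 0 < α) (hβ : 0 ≤ β) (s : ℝ) :
    0 < α + β * Real.sin s ^ 2 := by positivity

theorem continuous_elliptic_integrand (hα : 0 < α) (hβ : 0 ≤ β) :
    Continuous fun s : ℝ => 1 / √(α + β * Real.sin s ^ 2) := by
  have : ∀ s, √(α + β * Real.sin s ^ 2) ≠ 0 := fun s =>
    (Real.sqrt_pos.2 (elliptic_radicand_pos hα hβ s)).ne'
  fun_prop (disch := assumption)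

theorem intervalIntegrable_elliptic (hα : 0 < α) (hβ : 0 ≤ β) (x y : ℝ) :
    IntervalIntegrable (fun s : ℝ => 1 / √(α + β * Real.sin s ^ 2)) MeasureTheory.volume x y :=
  (continuous_elliptic_integrand hα hβ).intervalIntegrable x y

theorem hasDerivAt_ellipticF (hα : 0 < α) (hβ : 0 ≤ β) (x : ℝ) :
    HasDerivAt (ellipticF α β) (1 / √(α + β * Real.sin x ^ 2)) x :=
  (continuous_elliptic_integrand hα hβ).integral_hasStrictDerivAt 0 x |>.hasDerivAt

theorem strictMono_ellipticF (hα : 0 < α) (hβ : 0 ≤ β) : StrictMono (ellipticF α β) := by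
  refine strictMono_of_deriv_pos fun x => ?_
  rw [(hasDerivAt_ellipticF hα hβ x).deriv]
  have := elliptic_radicand_pos hα hβ x
  positivity

theorem ellipticF_add_pi (hα : 0 < α) (hβ : 0 ≤ β) (x : ℝ) :
    ellipticF α β (x + Real.pi) = ellipticF α β x + ellipticF α β Real.pi := by
  have hp : Function.Periodic (fun s : ℝ => 1 / √(α + β * Real.sin s ^ 2)) Real.pi := by
    intro s; simp [Real.sin_add_pi]
  have h := hp.intervalIntegral_add_eq x 0
  rw [zero_add] at h
  unfold ellipticF
  rw [← h, intervalIntegral.integral_add_adjacent_intervals] <;>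
    exact intervalIntegrable_elliptic hα hβ _ _

theorem ellipticF_neg (x : ℝ) : ellipticF α β (-x) = -ellipticF α β x := by
  have h := intervalIntegral.integral_comp_neg (a := 0) (b := x)
    (fun s : ℝ => 1 / √(α + β * Real.sin s ^ 2))
  simp only [Real.sin_neg, neg_sq, neg_zero] at h
  rw [ellipticF, ellipticF, h, ← intervalIntegral.integral_symm]

theorem ellipticF_pi (hα : 0 < α) (hβ : 0 ≤ β) :
    ellipticF α β Real.pi = 2 * ellipticF α β (Real.pi / 2) := by
  have h := ellipticF_add_pi hα hβ (-(Real.pi / 2))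
  rw [ellipticF_neg, show -(Real.pi / 2) + Real.pi = Real.pi / 2 by ring] at h
  linarith

theorem ellipticF_add_nat_mul_pi (hα : 0 < α) (hβ : 0 ≤ β) (x : ℝ) (n : ℕ) :
    ellipticF α β (x + n * Real.pi) = ellipticF α β x + 2 * n * ellipticF α β (Real.pi / 2) := by
  induction n with
  | zero => simp
  | succ n ih =>
    rw [show x + ((n + 1 : ℕ) : ℝ) * Real.pi = x + n * Real.pi + Real.pi by push_cast; ring,
      ellipticF_add_pi hα hβ, ih, ellipticF_pi hα hβ]
    push_cast; ring

theorem ellipticF_pi_div_two_pos (hα : 0 < α) (hβ : 0 ≤ β) :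
    0 < ellipticF α β (Real.pi / 2) := by
  rw [← ellipticF_zero α β]
  exact strictMono_ellipticF hα hβ (by positivity)

theorem surjective_ellipticF (hα : 0 < α) (hβ : 0 ≤ β) :
    Function.Surjective (ellipticF α β) := by
  have hp : Function.Periodic (fun s : ℝ => 1 / √(α + β * Real.sin s ^ 2)) Real.pi := by
    intro s; simp [Real.sin_add_pi]
  have hpos : ∀ s : ℝ, 0 < 1 / √(α + β * Real.sin s ^ 2) := fun s => by
    have := elliptic_radicand_pos hα hβ s
    positivity
  have hc : Continuous (ellipticF α β) := continuous_iff_continuousAt.2 fun x =>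
    (hasDerivAt_ellipticF hα hβ x).continuousAt
  exact hc.surjective
    (hp.tendsto_atTop_intervalIntegral_of_pos' (intervalIntegrable_elliptic hα hβ _ _) hpos
      Real.pi_pos)
    (hp.tendsto_atBot_intervalIntegral_of_pos' (intervalIntegrable_elliptic hα hβ _ _) hpos
      Real.pi_pos)

/-- The elliptic integral as an increasing bijection of the line. -/
noncomputable def ellipticIso (hα : 0 < α) (hβ : 0 ≤ β) : ℝ ≃o ℝ :=
  StrictMono.orderIsoOfSurjective _ (strictMono_ellipticF hα hβ) (surjective_ellipticF hα hβ)

theorem ellipticAm_eq (hα : 0 < α) (hβ : 0 ≤ β) :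
    ellipticAm α β = (ellipticIso hα hβ).symm := by
  funext u
  apply (strictMono_ellipticF hα hβ).injective
  rw [ellipticAm, Function.rightInverse_invFun (surjective_ellipticF hα hβ)]
  exact ((ellipticIso hα hβ).apply_symm_apply u).symm

theorem ellipticF_am (hα : 0 < α) (hβ : 0 ≤ β) (u : ℝ) :
    ellipticF α β (ellipticAm α β u) = u :=
  Function.rightInverse_invFun (surjective_ellipticF hα hβ) u

theorem ellipticAm_F (hα : 0 < α) (hβ : 0 ≤ β) (x : ℝ) :
    ellipticAm α β (ellipticF α β x) = x :=
  Function.leftInverse_invFun (strictMono_ellipticF hα hβ).injective x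

theorem ellipticAm_zero (hα : 0 < α) (hβ : 0 ≤ β) : ellipticAm α β 0 = 0 := by
  simpa [ellipticF_zero] using ellipticAm_F hα hβ 0

theorem strictMono_ellipticAm (hα : 0 < α) (hβ : 0 ≤ β) : StrictMono (ellipticAm α β) :=
  ellipticAm_eq hα hβ ▸ (ellipticIso hα hβ).symm.strictMono

theorem ellipticAm_add (hα : 0 < α) (hβ : 0 ≤ β) (u : ℝ) (n : ℕ) :
    ellipticAm α β (u + 2 * n * ellipticF α β (Real.pi / 2)) =
      ellipticAm α β u + n * Real.pi := by
  rw [← ellipticAm_F hα hβ (ellipticAm α β u + n * Real.pi), ellipticF_add_nat_mul_pi hα hβ,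
    ellipticF_am hα hβ]

theorem hasDerivAt_ellipticAm (hα : 0 < α) (hβ : 0 ≤ β) (u : ℝ) :
    HasDerivAt (ellipticAm α β) (√(α + β * Real.sin (ellipticAm α β u) ^ 2)) u := by
  have h := (ellipticIso hα hβ).hasDerivAt_symm (y := u)
    (hasDerivAt_ellipticF hα hβ _) (by
      have := elliptic_radicand_pos hα hβ ((ellipticIso hα hβ).symm u)
      positivity)
  rwa [one_div, inv_inv, ← ellipticAm_eq] at h

/-- The square root in the derivative of the amplitude cancels the one produced by the chain rule,
which is why the momenta of the oscillators have polynomial derivatives. -/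
theorem hasDerivAt_ellipticDelta (hα : 0 < α) (hβ : 0 ≤ β) (u : ℝ) :
    HasDerivAt (fun u => √(α + β * Real.sin (ellipticAm α β u) ^ 2))
      (β * Real.sin (ellipticAm α β u) * Real.cos (ellipticAm α β u)) u := by
  have hpos := elliptic_radicand_pos hα hβ (ellipticAm α β u)
  have h := ((((hasDerivAt_ellipticAm hα hβ u).sin.pow 2).const_mul β).const_add α).sqrt hpos.ne'
  refine h.congr_deriv ?_
  have := (Real.sqrt_pos.2 hpos).ne'
  simp only [Pi.pow_apply, Nat.cast_ofNat, Nat.reduceSub, pow_one]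
  field_simp

theorem ellipticF_le (hα : 0 < α) (hβ : 0 ≤ β) {x : ℝ} (hx : 0 ≤ x) :
    ellipticF α β x ≤ x / √α := by
  have h : ellipticF α β x ≤ ∫ _ in (0 : ℝ)..x, 1 / √α := by
    refine intervalIntegral.integral_mono_on hx (intervalIntegrable_elliptic hα hβ _ _)
      intervalIntegrable_const fun s _ => ?_
    have : √α ≤ √(α + β * Real.sin s ^ 2) := Real.sqrt_le_sqrt (by
      have : 0 ≤ β * Real.sin s ^ 2 := by positivity
      linarith)
    exact one_div_le_one_div_of_le (Real.sqrt_pos.2 hα) this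
  rw [intervalIntegral.integral_const] at h
  simpa [div_eq_mul_inv] using h

/-- Since |sin s| ≤ |s|, the radical is at most √α + √β s, whose reciprocal integrates to a
logarithm. This bound diverges as α → 0 and is the source of the blow-up of the frequency ratio. -/
theorem le_ellipticF (hα : 0 < α) (hβ : 0 < β) {x : ℝ} (hx : 0 ≤ x) :
    Real.log (1 + √(β / α) * x) / √β ≤ ellipticF α β x := by
  have hα' := Real.sqrt_pos.2 hα
  have hβ' := Real.sqrt_pos.2 hβ
  have hd : ∀ s ∈ uIcc 0 x, HasDerivAt (fun s => Real.log (1 + √(β / α) * s) / √β)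
      (1 / (√α + √β * s)) s := by
    intro s hs
    rw [uIcc_of_le hx] at hs
    have h1 : 0 < 1 + √(β / α) * s := by have := hs.1; positivity
    have h2 : 0 < √α + √β * s := by have := hs.1; positivity
    have := ((((hasDerivAt_id s).const_mul √(β / α)).const_add 1).log h1.ne').div_const √β
    refine this.congr_deriv ?_
    simp only [id, mul_one]
    rw [Real.sqrt_div hβ.le]
    have h3 : 1 + √β / √α * s = (√α + √β * s) / √α := by field_simp
    rw [h3]
    field_simp
  have hI : IntervalIntegrable (fun s => 1 / (√α + √β * s)) MeasureTheory.volume 0 x := by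
    refine ContinuousOn.intervalIntegrable fun s hs => ContinuousAt.continuousWithinAt ?_
    rw [uIcc_of_le hx] at hs
    have h2 : √α + √β * s ≠ 0 := by have := hs.1; positivity
    fun_prop (disch := assumption)
  have h := intervalIntegral.integral_eq_sub_of_hasDerivAt hd hI
  simp only [mul_zero, add_zero, Real.log_one, zero_div, sub_zero] at h
  rw [← h]
  refine intervalIntegral.integral_mono_on hx hI (intervalIntegrable_elliptic hα hβ.le _ _)
    fun s hs => ?_
  have hr := elliptic_radicand_pos hα hβ.le s
  refine one_div_le_one_div_of_le (Real.sqrt_pos.2 hr) ?_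
  have h2 : 0 ≤ √β * s := mul_nonneg hβ'.le hs.1
  rw [Real.sqrt_le_left (by positivity)]
  have h3 : Real.sin s ^ 2 ≤ s ^ 2 := sq_le_sq.2 (Real.abs_sin_le_abs)
  have h4 := Real.sq_sqrt hα.le
  have h5 := Real.sq_sqrt hβ.le
  have h6 : β * Real.sin s ^ 2 ≤ β * s ^ 2 := by gcongr
  have h7 : 0 ≤ √α * (√β * s) := by positivity
  nlinarith

end

/-! ### Levi-Civita regularization -/

/-- `(ξ, η)` with momenta `(p, s)` solves the regularized Stark problem at physical energy `h`. -/
structure IsRegularizedOrbit (h : ℝ) (ξ p η s : ℝ → ℝ) : Prop where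
  deriv_ξ : ∀ u, HasDerivAt ξ (p u) u
  deriv_p : ∀ u, HasDerivAt p (2 * ξ u ^ 3 + 2 * h * ξ u) u
  deriv_η : ∀ u, HasDerivAt η (s u) u
  deriv_s : ∀ u, HasDerivAt s (-2 * η u ^ 3 + 2 * h * η u) u
  -- The physical energy relation multiplied by 2(ξ² + η²); at a collision it leaves p² + s² = 4, so
  -- the momenta do not vanish there.
  energy : ∀ u, p u ^ 2 + s u ^ 2 = 4 + ξ u ^ 4 - η u ^ 4 + 2 * h * (ξ u ^ 2 + η u ^ 2)

/-- The physical time along a regularized orbit. -/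
noncomputable def physicalTime (ξ η : ℝ → ℝ) (u : ℝ) : ℝ :=
  ∫ w in (0 : ℝ)..u, (ξ w ^ 2 + η w ^ 2)

theorem physicalTime_zero (ξ η : ℝ → ℝ) : physicalTime ξ η 0 = 0 := by simp [physicalTime]

namespace IsRegularizedOrbit

variable {h : ℝ} {ξ p η s : ℝ → ℝ}

theorem continuous_ξ (H : IsRegularizedOrbit h ξ p η s) : Continuous ξ :=
  continuous_iff_continuousAt.2 fun u => (H.deriv_ξ u).continuousAt

theorem continuous_η (H : IsRegularizedOrbit h ξ p η s) : Continuous η :=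
  continuous_iff_continuousAt.2 fun u => (H.deriv_η u).continuousAt

theorem continuous_p (H : IsRegularizedOrbit h ξ p η s) : Continuous p :=
  continuous_iff_continuousAt.2 fun u => (H.deriv_p u).continuousAt

theorem continuous_s (H : IsRegularizedOrbit h ξ p η s) : Continuous s :=
  continuous_iff_continuousAt.2 fun u => (H.deriv_s u).continuousAt

theorem hasDerivAt_physicalTime (H : IsRegularizedOrbit h ξ p η s) (u : ℝ) :
    HasDerivAt (physicalTime ξ η) (ξ u ^ 2 + η u ^ 2) u := by
  have hc : Continuous fun w => ξ w ^ 2 + η w ^ 2 :=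
    (H.continuous_ξ.pow 2).add (H.continuous_η.pow 2)
  exact (hc.integral_hasStrictDerivAt 0 u).hasDerivAt

/-- Time can only stall where ξ = η = 0. On a whole interval of such points p and s would vanish as
well, and the energy relation would read 0 = 4. -/
theorem strictMono_physicalTime (H : IsRegularizedOrbit h ξ p η s) :
    StrictMono (physicalTime ξ η) := by
  have hmono : Monotone (physicalTime ξ η) := monotone_of_deriv_nonneg
    (fun u => (H.hasDerivAt_physicalTime u).differentiableAt) fun u => by
      rw [(H.hasDerivAt_physicalTime u).deriv]; positivity
  refine hmono.strictMono_of_injective fun u w huw => ?_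
  by_contra hne
  wlog hlt : u < w
  · exact this H hmono w u huw.symm (Ne.symm hne) (lt_of_le_of_ne (not_lt.1 hlt) (Ne.symm hne))
  have hzero : ∀ z ∈ Ioo u w, ξ z ^ 2 + η z ^ 2 = 0 := fun z hz => by
    refine (H.hasDerivAt_physicalTime z).unique ?_
    refine (hasDerivAt_const z (physicalTime ξ η u)).congr_of_eventuallyEq ?_
    filter_upwards [isOpen_Ioo.mem_nhds hz] with y hy
    exact le_antisymm (huw ▸ hmono hy.2.le) (hmono hy.1.le)
  have hξ : ∀ z ∈ Ioo u w, ξ z = 0 := fun z hz => by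
    have := hzero z hz
    nlinarith [sq_nonneg (ξ z), sq_nonneg (η z)]
  have hη : ∀ z ∈ Ioo u w, η z = 0 := fun z hz => by
    have := hzero z hz
    nlinarith [sq_nonneg (ξ z), sq_nonneg (η z)]
  have hm : (u + w) / 2 ∈ Ioo u w := ⟨by linarith, by linarith⟩
  have hp : p ((u + w) / 2) = 0 := (H.deriv_ξ _).unique <|
    (hasDerivAt_const _ (0 : ℝ)).congr_of_eventuallyEq <| by
      filter_upwards [isOpen_Ioo.mem_nhds hm] with y hy using hξ y hy
  have hs : s ((u + w) / 2) = 0 := (H.deriv_η _).unique <|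
    (hasDerivAt_const _ (0 : ℝ)).congr_of_eventuallyEq <| by
      filter_upwards [isOpen_Ioo.mem_nhds hm] with y hy using hη y hy
  have := H.energy ((u + w) / 2)
  rw [hp, hs, hξ _ hm, hη _ hm] at this
  norm_num at this

/-- If `ξ` and `p` are bounded and `ξ` carries the separation constant `c / 2 > 0`, then
the physical time is unbounded in both directions. -/
theorem surjective_physicalTime (H : IsRegularizedOrbit h ξ p η s) (hh : h < 0) {c M : ℝ}
    (hc : 0 < c) (hp : ∀ u, p u ^ 2 = ξ u ^ 4 + 2 * h * ξ u ^ 2 + c) (hM : ∀ u, |ξ u * p u| ≤ M) :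
    Function.Surjective (physicalTime ξ η) := by
  -- The derivative of ξp is 3ξ⁴ + 4hξ² + c; adding -4h times the physical time trades the term 4hξ²
  -- for -4hη² ≥ 0. By monotonicity, time grows at least like cu/(-4h), up to the bounded term ξp.
  have hd : ∀ u, HasDerivAt (fun u => -4 * h * physicalTime ξ η u - c * u + ξ u * p u)
      (-4 * h * η u ^ 2 + 3 * ξ u ^ 4) u := fun u => by
    refine ((((H.hasDerivAt_physicalTime u).const_mul (-4 * h)).sub
      ((hasDerivAt_id u).const_mul c)).add ((H.deriv_ξ u).mul (H.deriv_p u))).congr_deriv ?_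
    linear_combination hp u
  have hmono := monotone_of_deriv_nonneg (fun u => (hd u).differentiableAt) fun u => by
    rw [(hd u).deriv]
    have := mul_nonneg (neg_nonneg.2 hh.le) (sq_nonneg (η u))
    have h4 : 0 ≤ ξ u ^ 4 := by positivity
    linarith
  have hcont : Continuous (physicalTime ξ η) := continuous_iff_continuousAt.2 fun u =>
    (H.hasDerivAt_physicalTime u).continuousAt
  have hk : 0 < -4 * h := by linarith
  have hck : 0 < c / (-4 * h) := div_pos hc hk
  refine hcont.surjective ?_ ?_
  · refine tendsto_atTop_mono' _ (f₁ := fun u => (c / (-4 * h)) * u + (-2 * M) / (-4 * h)) ?_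
      (tendsto_atTop_add_const_right _ _ (tendsto_id.const_mul_atTop hck))
    filter_upwards [eventually_ge_atTop 0] with u hu
    have := hmono hu
    simp only [physicalTime_zero] at this
    have h1 := abs_le.1 (hM 0)
    have h2 := abs_le.1 (hM u)
    rw [div_mul_eq_mul_div, ← add_div, div_le_iff₀ hk]
    linarith
  · refine tendsto_atBot_mono' _ (f₁ := fun u => (c / (-4 * h)) * u + (2 * M) / (-4 * h)) ?_
      (tendsto_atBot_add_const_right _ _ (tendsto_id.const_mul_atBot hck))
    filter_upwards [eventually_le_atBot 0] with u hu
    have := hmono hu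
    simp only [physicalTime_zero] at this
    have h1 := abs_le.1 (hM 0)
    have h2 := abs_le.1 (hM u)
    rw [div_mul_eq_mul_div, ← add_div, le_div_iff₀ hk]
    linarith

/-- A regularized orbit read in physical time `t`, where `σ t` is the regularized time. -/
theorem hasDerivAt_comp_x (H : IsRegularizedOrbit h ξ p η s) {σ : ℝ → ℝ} {t : ℝ}
    (hσ : HasDerivAt σ (ξ (σ t) ^ 2 + η (σ t) ^ 2)⁻¹ t) :
    HasDerivAt (fun t => (ξ (σ t) ^ 2 - η (σ t) ^ 2) / 2)
      ((ξ (σ t) * p (σ t) - η (σ t) * s (σ t)) / (ξ (σ t) ^ 2 + η (σ t) ^ 2)) t := by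
  refine ((((H.deriv_ξ (σ t)).comp t hσ).pow 2).sub
    (((H.deriv_η (σ t)).comp t hσ).pow 2) |>.div_const 2).congr_deriv ?_
  simp only [Function.comp]
  ring

theorem hasDerivAt_comp_y (H : IsRegularizedOrbit h ξ p η s) {σ : ℝ → ℝ} {t : ℝ}
    (hσ : HasDerivAt σ (ξ (σ t) ^ 2 + η (σ t) ^ 2)⁻¹ t) :
    HasDerivAt (fun t => ξ (σ t) * η (σ t))
      ((p (σ t) * η (σ t) + ξ (σ t) * s (σ t)) / (ξ (σ t) ^ 2 + η (σ t) ^ 2)) t := by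
  refine (((H.deriv_ξ (σ t)).comp t hσ).mul ((H.deriv_η (σ t)).comp t hσ)).congr_deriv ?_
  simp only [Function.comp]
  ring

/-- The map (ξ, η) ↦ (x, y) is half the complex square, so r = (ξ² + η²)/2. Differentiating the
velocity leaves a term in p² + s², and the energy relation turns it into the Kepler force. -/
theorem isStarkSolutionOn_comp (H : IsRegularizedOrbit h ξ p η s) {σ : ℝ → ℝ} {I : Set ℝ}
    (hI : IsOpen I) (hσ : ∀ t ∈ I, HasDerivAt σ (ξ (σ t) ^ 2 + η (σ t) ^ 2)⁻¹ t)
    (hne : ∀ t ∈ I, ξ (σ t) ^ 2 + η (σ t) ^ 2 ≠ 0) :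
    IsStarkSolutionOn (fun t => (ξ (σ t) ^ 2 - η (σ t) ^ 2) / 2) (fun t => ξ (σ t) * η (σ t)) I := by
  have hr : ∀ t, √(((ξ (σ t) ^ 2 - η (σ t) ^ 2) / 2) ^ 2 + (ξ (σ t) * η (σ t)) ^ 2) =
      (ξ (σ t) ^ 2 + η (σ t) ^ 2) / 2 := fun t => by
    rw [show ((ξ (σ t) ^ 2 - η (σ t) ^ 2) / 2) ^ 2 + (ξ (σ t) * η (σ t)) ^ 2 =
      ((ξ (σ t) ^ 2 + η (σ t) ^ 2) / 2) ^ 2 by ring]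
    exact Real.sqrt_sq (by positivity)
  refine ⟨fun t ht h0 => ?_, fun t ht => (H.hasDerivAt_comp_x (hσ t ht)).differentiableAt,
    fun t ht => (H.hasDerivAt_comp_y (hσ t ht)).differentiableAt, fun t ht => ?_, fun t ht => ?_⟩
  · have h1 := hr t
    rw [h0.1, h0.2] at h1
    simp only [ne_eq, OfNat.ofNat_ne_zero, not_false_eq_true, zero_pow, add_zero,
      Real.sqrt_zero] at h1
    exact hne t ht (by linarith)
  · have he : deriv (fun t => (ξ (σ t) ^ 2 - η (σ t) ^ 2) / 2) =ᶠ[𝓝 t] fun t =>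
        (ξ (σ t) * p (σ t) - η (σ t) * s (σ t)) / (ξ (σ t) ^ 2 + η (σ t) ^ 2) := by
      filter_upwards [hI.mem_nhds ht] with y hy using (H.hasDerivAt_comp_x (hσ y hy)).deriv
    have hξ := (H.deriv_ξ (σ t)).comp t (hσ t ht)
    have hη := (H.deriv_η (σ t)).comp t (hσ t ht)
    have hp := (H.deriv_p (σ t)).comp t (hσ t ht)
    have hs := (H.deriv_s (σ t)).comp t (hσ t ht)
    have hz := hne t ht
    refine (((hξ.mul hp).sub (hη.mul hs)).div ((hξ.pow 2).add (hη.pow 2)) hz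
      |>.congr_of_eventuallyEq he).congr_deriv ?_
    rw [hr]
    have hen := H.energy (σ t)
    simp only [Function.comp, Pi.mul_apply, Pi.sub_apply, Pi.add_apply, Pi.pow_apply]
    generalize ξ (σ t) = X at *
    generalize η (σ t) = Y at *
    generalize p (σ t) = P at *
    generalize s (σ t) = S at *
    field_simp
    push_cast
    simp only [pow_one]
    linear_combination (-(X ^ 2 - Y ^ 2)) * hen
  · have he : deriv (fun t => ξ (σ t) * η (σ t)) =ᶠ[𝓝 t] fun t =>
        (p (σ t) * η (σ t) + ξ (σ t) * s (σ t)) / (ξ (σ t) ^ 2 + η (σ t) ^ 2) := by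
      filter_upwards [hI.mem_nhds ht] with y hy using (H.hasDerivAt_comp_y (hσ y hy)).deriv
    have hξ := (H.deriv_ξ (σ t)).comp t (hσ t ht)
    have hη := (H.deriv_η (σ t)).comp t (hσ t ht)
    have hp := (H.deriv_p (σ t)).comp t (hσ t ht)
    have hs := (H.deriv_s (σ t)).comp t (hσ t ht)
    have hz := hne t ht
    refine (((hp.mul hη).add (hξ.mul hs)).div ((hξ.pow 2).add (hη.pow 2)) hz
      |>.congr_of_eventuallyEq he).congr_deriv ?_
    rw [hr]
    have hen := H.energy (σ t)
    simp only [Function.comp, Pi.mul_apply, Pi.add_apply, Pi.pow_apply]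
    generalize ξ (σ t) = X at *
    generalize η (σ t) = Y at *
    generalize p (σ t) = P at *
    generalize s (σ t) = S at *
    field_simp
    push_cast
    simp only [pow_one]
    linear_combination (-(2 * X * Y)) * hen

end IsRegularizedOrbit

/-! ### Explicit orbits in the well `v ^ 2 < 2 / a - 2 * a` -/

/-- The energy of the orbit started perpendicularly at `(a, 0)` with speed `v`. -/
noncomputable def starkEnergy (a v : ℝ) : ℝ := v ^ 2 / 2 - 1 / a - a

/-- The gap between the squares of the two turning points of `ξ`. -/
noncomputable def starkGap (a v : ℝ) : ℝ := 2 / a - 2 * a - v ^ 2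

/-- The opposite of the negative root of `-w ^ 2 + 2 * h * w + 2 * a * v ^ 2`. -/
noncomputable def starkQ (a v : ℝ) : ℝ :=
  -starkEnergy a v + √(starkEnergy a v ^ 2 + 2 * a * v ^ 2)

/-- The amplitude of `η`. -/
noncomputable def starkB (a v : ℝ) : ℝ := v * √(2 * a) / √(starkQ a v)

/-- The two equations separate as p² = (2a - ξ²)(2a + gap - ξ²) and s² = (B² - η²)(Q + η²).
Substituting ξ = √(2a) cos θ and η = B sin φ gives θ'² = gap + 2a sin² θ and φ'² = Q + B² sin² φ. -/
noncomputable def starkθ (a v : ℝ) : ℝ → ℝ := ellipticAm (starkGap a v) (2 * a)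

noncomputable def starkφ (a v : ℝ) : ℝ → ℝ := ellipticAm (starkQ a v) (starkB a v ^ 2)

noncomputable def starkξ (a v u : ℝ) : ℝ := √(2 * a) * Real.cos (starkθ a v u)

noncomputable def starkP (a v u : ℝ) : ℝ := √(2 * a) *
  (-Real.sin (starkθ a v u) * √(starkGap a v + 2 * a * Real.sin (starkθ a v u) ^ 2))

noncomputable def starkη (a v u : ℝ) : ℝ := starkB a v * Real.sin (starkφ a v u)

noncomputable def starkS (a v u : ℝ) : ℝ := starkB a v *
  (Real.cos (starkφ a v u) * √(starkQ a v + starkB a v ^ 2 * Real.sin (starkφ a v u) ^ 2))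

/-- The first positive zero of `ξ`. -/
noncomputable def starkK (a v : ℝ) : ℝ := ellipticF (starkGap a v) (2 * a) (Real.pi / 2)

/-- The half-distance between two zeros of `η`. -/
noncomputable def starkL (a v : ℝ) : ℝ := ellipticF (starkQ a v) (starkB a v ^ 2) (Real.pi / 2)

section
variable {a v : ℝ}

theorem starkGap_pos (hv : v ^ 2 < 2 / a - 2 * a) : 0 < starkGap a v := by
  unfold starkGap; linarith

theorem neg_two_mul_starkEnergy (a v : ℝ) : -2 * starkEnergy a v = starkGap a v + 4 * a := by
  unfold starkEnergy starkGap; ring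

theorem starkEnergy_neg (ha : 0 < a) (hv : v ^ 2 < 2 / a - 2 * a) : starkEnergy a v < 0 := by
  have := neg_two_mul_starkEnergy a v
  have := starkGap_pos hv
  linarith

theorem starkEnergy_discrim_nonneg (ha : 0 < a) (v : ℝ) :
    0 ≤ starkEnergy a v ^ 2 + 2 * a * v ^ 2 := by positivity

theorem starkQ_ge (ha : 0 < a) (v : ℝ) : -2 * starkEnergy a v ≤ starkQ a v := by
  have : |starkEnergy a v| ≤ √(starkEnergy a v ^ 2 + 2 * a * v ^ 2) := by
    rw [← Real.sqrt_sq_eq_abs]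
    exact Real.sqrt_le_sqrt (by have : 0 ≤ 2 * a * v ^ 2 := by positivity
                                linarith)
  have := neg_abs_le (starkEnergy a v)
  unfold starkQ
  linarith

theorem four_mul_le_starkQ (ha : 0 < a) (hv : v ^ 2 < 2 / a - 2 * a) : 4 * a ≤ starkQ a v := by
  have := neg_two_mul_starkEnergy a v
  have := starkGap_pos hv
  have := starkQ_ge ha v
  linarith

theorem starkQ_pos (ha : 0 < a) (hv : v ^ 2 < 2 / a - 2 * a) : 0 < starkQ a v := by
  have := four_mul_le_starkQ ha hv
  linarith

theorem starkQ_sq (ha : 0 < a) (v : ℝ) :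
    starkQ a v ^ 2 = 2 * a * v ^ 2 - 2 * starkEnergy a v * starkQ a v := by
  have := Real.sq_sqrt (starkEnergy_discrim_nonneg ha v)
  unfold starkQ
  linear_combination this

/-- With `starkB_sq`, Vieta's formulas: B² and -Q are the two roots of -w² + 2hw + 2av². -/
theorem starkB_sq_mul (ha : 0 < a) (hv : v ^ 2 < 2 / a - 2 * a) :
    starkB a v ^ 2 * starkQ a v = 2 * a * v ^ 2 := by
  have hq := starkQ_pos ha hv
  rw [starkB, div_pow, mul_pow, Real.sq_sqrt hq.le, Real.sq_sqrt (by positivity)]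
  field_simp

theorem starkB_sq (ha : 0 < a) (hv : v ^ 2 < 2 / a - 2 * a) :
    starkB a v ^ 2 = starkQ a v + 2 * starkEnergy a v := by
  have hq := starkQ_pos ha hv
  apply mul_right_cancel₀ hq.ne'
  linear_combination starkB_sq_mul ha hv - starkQ_sq ha v

theorem starkB_ne_zero (ha : 0 < a) (hv : v ^ 2 < 2 / a - 2 * a) (hv0 : v ≠ 0) :
    starkB a v ≠ 0 := by
  have hq := Real.sqrt_pos.2 (starkQ_pos ha hv)
  have h2 := Real.sqrt_pos.2 (show 0 < 2 * a by positivity)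
  exact div_ne_zero (mul_ne_zero hv0 h2.ne') hq.ne'

theorem starkP_sq (ha : 0 < a) (hv : v ^ 2 < 2 / a - 2 * a) (u : ℝ) :
    starkP a v u ^ 2 = starkξ a v u ^ 4 + 2 * starkEnergy a v * starkξ a v u ^ 2 +
      2 * a * (starkGap a v + 2 * a) := by
  have h1 := Real.sq_sqrt (show 0 ≤ 2 * a by positivity)
  have h2 := Real.sq_sqrt
    (elliptic_radicand_pos (starkGap_pos hv) (show 0 ≤ 2 * a by positivity) (starkθ a v u)).le
  have h3 := Real.sin_sq (starkθ a v u)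
  have h4 : starkξ a v u ^ 2 = 2 * a * Real.cos (starkθ a v u) ^ 2 := by
    rw [starkξ, mul_pow, h1]
  rw [show starkξ a v u ^ 4 = (starkξ a v u ^ 2) ^ 2 by ring, h4, starkP, mul_pow, mul_pow, h1,
    h2, neg_sq, h3]
  linear_combination (2 * a * Real.cos (starkθ a v u) ^ 2) * neg_two_mul_starkEnergy a v

theorem starkS_sq (ha : 0 < a) (hv : v ^ 2 < 2 / a - 2 * a) (u : ℝ) :
    starkS a v u ^ 2 = -starkη a v u ^ 4 + 2 * starkEnergy a v * starkη a v u ^ 2 +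
      2 * a * v ^ 2 := by
  have h2 := Real.sq_sqrt
    (elliptic_radicand_pos (starkQ_pos ha hv) (sq_nonneg (starkB a v)) (starkφ a v u)).le
  have h3 := Real.cos_sq' (starkφ a v u)
  rw [starkS, mul_pow, mul_pow, h2, h3, starkη]
  linear_combination starkB_sq_mul ha hv +
    starkB a v ^ 2 * Real.sin (starkφ a v u) ^ 2 * starkB_sq ha hv

theorem isRegularizedOrbit_stark (ha : 0 < a) (hv : v ^ 2 < 2 / a - 2 * a) :
    IsRegularizedOrbit (starkEnergy a v) (starkξ a v) (starkP a v) (starkη a v)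
      (starkS a v) where
  deriv_ξ u := ((hasDerivAt_ellipticAm (starkGap_pos hv) (by positivity) u).cos).const_mul _
  deriv_p u := by
    have hb : 0 ≤ 2 * a := by positivity
    refine (((hasDerivAt_ellipticAm (starkGap_pos hv) hb u).sin.neg.mul
      (hasDerivAt_ellipticDelta (starkGap_pos hv) hb u)).const_mul √(2 * a)).congr_deriv ?_
    have h1 := Real.sq_sqrt hb
    have h2 := Real.sq_sqrt
      (elliptic_radicand_pos (starkGap_pos hv) hb (starkθ a v u)).le
    have h3 := Real.sin_sq (starkθ a v u)
    simp only [starkξ, Pi.neg_apply]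
    change √(2 * a) * (-(Real.cos (starkθ a v u) *
      √(starkGap a v + 2 * a * Real.sin (starkθ a v u) ^ 2)) *
      √(starkGap a v + 2 * a * Real.sin (starkθ a v u) ^ 2) +
      -Real.sin (starkθ a v u) * (2 * a * Real.sin (starkθ a v u) * Real.cos (starkθ a v u))) = _
    have h4 := neg_two_mul_starkEnergy a v
    generalize √(starkGap a v + 2 * a * Real.sin (starkθ a v u) ^ 2) = D at *
    generalize √(2 * a) = R at *
    generalize Real.cos (starkθ a v u) = C at *
    generalize Real.sin (starkθ a v u) = S at *
    linear_combination (-R * C) * h2 - 4 * a * R * C * h3 + R * C * h4 - 2 * R * C ^ 3 * h1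
  deriv_η u := ((hasDerivAt_ellipticAm (starkQ_pos ha hv) (sq_nonneg _) u).sin).const_mul _
  deriv_s u := by
    have hb := sq_nonneg (starkB a v)
    refine (((hasDerivAt_ellipticAm (starkQ_pos ha hv) hb u).cos.mul
      (hasDerivAt_ellipticDelta (starkQ_pos ha hv) hb u)).const_mul (starkB a v)).congr_deriv ?_
    have h2 := Real.sq_sqrt
      (elliptic_radicand_pos (starkQ_pos ha hv) hb (starkφ a v u)).le
    have h3 := Real.cos_sq' (starkφ a v u)
    simp only [starkη]
    change starkB a v * (-Real.sin (starkφ a v u) *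
      √(starkQ a v + starkB a v ^ 2 * Real.sin (starkφ a v u) ^ 2) *
      √(starkQ a v + starkB a v ^ 2 * Real.sin (starkφ a v u) ^ 2) +
      Real.cos (starkφ a v u) *
        (starkB a v ^ 2 * Real.sin (starkφ a v u) * Real.cos (starkφ a v u))) = _
    have h4 := starkB_sq ha hv
    generalize √(starkQ a v + starkB a v ^ 2 * Real.sin (starkφ a v u) ^ 2) = D at *
    generalize Real.cos (starkφ a v u) = C at *
    generalize Real.sin (starkφ a v u) = S at *
    linear_combination (-starkB a v * S) * h2 + starkB a v ^ 3 * S * h3 + starkB a v * S * h4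
  energy u := by
    rw [starkP_sq ha hv, starkS_sq ha hv]
    -- The separation constants of ξ and η, namely 2a(2/a - v²) and 2av², add up to the constant 4
    -- of the energy relation.
    have : 2 * a * (starkGap a v + 2 * a) + 2 * a * v ^ 2 = 4 := by
      unfold starkGap; field_simp; ring
    linear_combination this

/-! ### Physical time and the explicit orbit in Cartesian coordinates -/

theorem surjective_starkTime (ha : 0 < a) (hv : v ^ 2 < 2 / a - 2 * a) :
    Function.Surjective (physicalTime (starkξ a v) (starkη a v)) := by
  have hg := starkGap_pos hv
  have hh := neg_two_mul_starkEnergy a v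
  refine (isRegularizedOrbit_stark ha hv).surjective_physicalTime (starkEnergy_neg ha hv)
    (c := 2 * a * (starkGap a v + 2 * a)) (by positivity) (starkP_sq ha hv)
    (M := 2 * a + 2 * a * (starkGap a v + 2 * a)) fun u => ?_
  have h1 : starkξ a v u ^ 2 ≤ 2 * a := by
    rw [starkξ, mul_pow, Real.sq_sqrt (by positivity)]
    have := Real.cos_sq_le_one (starkθ a v u)
    nlinarith
  have h2 : starkP a v u ^ 2 ≤ 2 * a * (starkGap a v + 2 * a) := by
    rw [starkP_sq ha hv]
    have h3 := sq_nonneg (starkξ a v u)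
    nlinarith [mul_nonneg h3 (by linarith : 0 ≤ -2 * starkEnergy a v - starkξ a v u ^ 2)]
  rw [abs_le]
  constructor <;> nlinarith [sq_nonneg (starkξ a v u + starkP a v u),
    sq_nonneg (starkξ a v u - starkP a v u)]

/-- Physical time along the explicit orbit, as an increasing bijection of the line. -/
noncomputable def starkTime (ha : 0 < a) (hv : v ^ 2 < 2 / a - 2 * a) : ℝ ≃o ℝ :=
  StrictMono.orderIsoOfSurjective _ (isRegularizedOrbit_stark ha hv).strictMono_physicalTime
    (surjective_starkTime ha hv)

theorem starkTime_zero (ha : 0 < a) (hv : v ^ 2 < 2 / a - 2 * a) : starkTime ha hv 0 = 0 :=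
  physicalTime_zero _ _

theorem starkTime_symm_zero (ha : 0 < a) (hv : v ^ 2 < 2 / a - 2 * a) :
    (starkTime ha hv).symm 0 = 0 := by
  rw [OrderIso.symm_apply_eq, starkTime_zero]

theorem hasDerivAt_starkTime_symm (ha : 0 < a) (hv : v ^ 2 < 2 / a - 2 * a) {t : ℝ}
    (h : starkξ a v ((starkTime ha hv).symm t) ^ 2 + starkη a v ((starkTime ha hv).symm t) ^ 2
      ≠ 0) :
    HasDerivAt (starkTime ha hv).symm
      (starkξ a v ((starkTime ha hv).symm t) ^ 2 +
        starkη a v ((starkTime ha hv).symm t) ^ 2)⁻¹ t :=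
  (starkTime ha hv).hasDerivAt_symm
    ((isRegularizedOrbit_stark ha hv).hasDerivAt_physicalTime _) h

noncomputable def starkX (ha : 0 < a) (hv : v ^ 2 < 2 / a - 2 * a) (t : ℝ) : ℝ :=
  (starkξ a v ((starkTime ha hv).symm t) ^ 2 - starkη a v ((starkTime ha hv).symm t) ^ 2) / 2

noncomputable def starkY (ha : 0 < a) (hv : v ^ 2 < 2 / a - 2 * a) (t : ℝ) : ℝ :=
  starkξ a v ((starkTime ha hv).symm t) * starkη a v ((starkTime ha hv).symm t)

theorem continuous_starkX (ha : 0 < a) (hv : v ^ 2 < 2 / a - 2 * a) :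
    Continuous (starkX ha hv) := by
  have H := isRegularizedOrbit_stark ha hv
  have h1 := H.continuous_ξ
  have h2 := H.continuous_η
  have h3 := (starkTime ha hv).symm.continuous
  exact (((h1.comp h3).pow 2).sub ((h2.comp h3).pow 2)).div_const 2

theorem continuous_starkY (ha : 0 < a) (hv : v ^ 2 < 2 / a - 2 * a) :
    Continuous (starkY ha hv) := by
  have H := isRegularizedOrbit_stark ha hv
  have h3 := (starkTime ha hv).symm.continuous
  exact (H.continuous_ξ.comp h3).mul (H.continuous_η.comp h3)

theorem starkθ_K (ha : 0 < a) (hv : v ^ 2 < 2 / a - 2 * a) :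
    starkθ a v (starkK a v) = Real.pi / 2 :=
  ellipticAm_F (starkGap_pos hv) (by positivity) _

theorem starkθ_neg_K (ha : 0 < a) (hv : v ^ 2 < 2 / a - 2 * a) :
    starkθ a v (-starkK a v) = -(Real.pi / 2) := by
  rw [starkK, ← ellipticF_neg]
  exact ellipticAm_F (starkGap_pos hv) (by positivity) _

theorem starkξ_K (ha : 0 < a) (hv : v ^ 2 < 2 / a - 2 * a) : starkξ a v (starkK a v) = 0 := by
  rw [starkξ, starkθ_K ha hv, Real.cos_pi_div_two, mul_zero]

theorem starkK_pos (ha : 0 < a) (hv : v ^ 2 < 2 / a - 2 * a) : 0 < starkK a v :=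
  ellipticF_pi_div_two_pos (starkGap_pos hv) (by positivity)

theorem starkL_pos (ha : 0 < a) (hv : v ^ 2 < 2 / a - 2 * a) : 0 < starkL a v :=
  ellipticF_pi_div_two_pos (starkQ_pos ha hv) (sq_nonneg _)

theorem starkξ_pos (ha : 0 < a) (hv : v ^ 2 < 2 / a - 2 * a) {u : ℝ}
    (hu : u ∈ Ioo (-starkK a v) (starkK a v)) : 0 < starkξ a v u := by
  have hm : StrictMono (starkθ a v) :=
    strictMono_ellipticAm (starkGap_pos hv) (show 0 ≤ 2 * a by positivity)
  refine mul_pos (Real.sqrt_pos.2 (by positivity)) (Real.cos_pos_of_mem_Ioo ⟨?_, ?_⟩)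
  · rw [← starkθ_neg_K ha hv]; exact hm hu.1
  · rw [← starkθ_K ha hv]; exact hm hu.2

theorem starkφ_strictMono (ha : 0 < a) (hv : v ^ 2 < 2 / a - 2 * a) : StrictMono (starkφ a v) :=
  strictMono_ellipticAm (starkQ_pos ha hv) (sq_nonneg _)

theorem starkφ_zero (ha : 0 < a) (hv : v ^ 2 < 2 / a - 2 * a) : starkφ a v 0 = 0 :=
  ellipticAm_zero (starkQ_pos ha hv) (sq_nonneg _)

theorem starkφ_add (ha : 0 < a) (hv : v ^ 2 < 2 / a - 2 * a) (u : ℝ) (n : ℕ) :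
    starkφ a v (u + 2 * n * starkL a v) = starkφ a v u + n * Real.pi :=
  ellipticAm_add (starkQ_pos ha hv) (sq_nonneg _) u n

theorem starkφ_L (ha : 0 < a) (hv : v ^ 2 < 2 / a - 2 * a) :
    starkφ a v (starkL a v) = Real.pi / 2 :=
  ellipticAm_F (starkQ_pos ha hv) (sq_nonneg _) _

theorem starkθ_add (ha : 0 < a) (hv : v ^ 2 < 2 / a - 2 * a) (u : ℝ) :
    starkθ a v (u + 2 * starkK a v) = starkθ a v u + Real.pi := by
  have h := ellipticAm_add (starkGap_pos hv) (show 0 ≤ 2 * a by positivity) u 1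
  simp only [Nat.cast_one, mul_one, one_mul] at h
  exact h

theorem starkη_eq_zero_iff (ha : 0 < a) (hv : v ^ 2 < 2 / a - 2 * a) (hv0 : v ≠ 0) {u : ℝ} :
    starkη a v u = 0 ↔ Real.sin (starkφ a v u) = 0 := by
  simp [starkη, starkB_ne_zero ha hv hv0]

/-- The time at which the explicit orbit first reaches `ξ = 0`. -/
noncomputable def starkT (ha : 0 < a) (hv : v ^ 2 < 2 / a - 2 * a) : ℝ :=
  starkTime ha hv (starkK a v)

theorem starkT_pos (ha : 0 < a) (hv : v ^ 2 < 2 / a - 2 * a) : 0 < starkT ha hv := by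
  rw [← starkTime_zero ha hv]
  exact (starkTime ha hv).strictMono (starkK_pos ha hv)

theorem starkTime_neg_K_neg (ha : 0 < a) (hv : v ^ 2 < 2 / a - 2 * a) :
    starkTime ha hv (-starkK a v) < 0 := by
  rw [← starkTime_zero ha hv]
  exact (starkTime ha hv).strictMono (neg_neg_iff_pos.2 (starkK_pos ha hv))

theorem starkTime_symm_mem (ha : 0 < a) (hv : v ^ 2 < 2 / a - 2 * a) {t : ℝ}
    (ht : t ∈ Ioo (starkTime ha hv (-starkK a v)) (starkT ha hv)) :
    (starkTime ha hv).symm t ∈ Ioo (-starkK a v) (starkK a v) :=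
  ⟨(OrderIso.lt_symm_apply _).2 ht.1, (OrderIso.symm_apply_lt _).2 ht.2⟩

theorem starkξ_comp_pos (ha : 0 < a) (hv : v ^ 2 < 2 / a - 2 * a) {t : ℝ}
    (ht : t ∈ Ioo (starkTime ha hv (-starkK a v)) (starkT ha hv)) :
    0 < starkξ a v ((starkTime ha hv).symm t) :=
  starkξ_pos ha hv (starkTime_symm_mem ha hv ht)

theorem isStarkSolutionOn_of_ne (ha : 0 < a) (hv : v ^ 2 < 2 / a - 2 * a) {I : Set ℝ}
    (hI : IsOpen I) (h : ∀ t ∈ I, starkξ a v ((starkTime ha hv).symm t) ^ 2 +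
      starkη a v ((starkTime ha hv).symm t) ^ 2 ≠ 0) :
    IsStarkSolutionOn (starkX ha hv) (starkY ha hv) I :=
  (isRegularizedOrbit_stark ha hv).isStarkSolutionOn_comp hI
    (fun t ht => hasDerivAt_starkTime_symm ha hv (h t ht)) h

theorem isStarkSolutionOn_Ioo (ha : 0 < a) (hv : v ^ 2 < 2 / a - 2 * a) :
    IsStarkSolutionOn (starkX ha hv) (starkY ha hv)
      (Ioo (starkTime ha hv (-starkK a v)) (starkT ha hv)) :=
  isStarkSolutionOn_of_ne ha hv isOpen_Ioo fun t ht => by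
    have := starkξ_comp_pos ha hv ht
    positivity

theorem deriv_starkX (ha : 0 < a) (hv : v ^ 2 < 2 / a - 2 * a) {t u : ℝ}
    (hu : (starkTime ha hv).symm t = u) (h : starkξ a v u ^ 2 + starkη a v u ^ 2 ≠ 0) :
    deriv (starkX ha hv) t = (starkξ a v u * starkP a v u - starkη a v u * starkS a v u) /
      (starkξ a v u ^ 2 + starkη a v u ^ 2) := by
  subst hu
  exact ((isRegularizedOrbit_stark ha hv).hasDerivAt_comp_x
    (hasDerivAt_starkTime_symm ha hv h)).deriv

theorem deriv_starkY (ha : 0 < a) (hv : v ^ 2 < 2 / a - 2 * a) {t u : ℝ}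
    (hu : (starkTime ha hv).symm t = u) (h : starkξ a v u ^ 2 + starkη a v u ^ 2 ≠ 0) :
    deriv (starkY ha hv) t = (starkP a v u * starkη a v u + starkξ a v u * starkS a v u) /
      (starkξ a v u ^ 2 + starkη a v u ^ 2) := by
  subst hu
  exact ((isRegularizedOrbit_stark ha hv).hasDerivAt_comp_y
    (hasDerivAt_starkTime_symm ha hv h)).deriv

theorem startsFrom_stark (ha : 0 < a) (hv : v ^ 2 < 2 / a - 2 * a) :
    StartsFrom (starkX ha hv) (starkY ha hv) a v := by
  have hθ : starkθ a v 0 = 0 := ellipticAm_zero (starkGap_pos hv) (by positivity)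
  have hs := Real.sq_sqrt (show 0 ≤ 2 * a by positivity)
  have hq := Real.sqrt_pos.2 (starkQ_pos ha hv)
  have h1 : starkξ a v 0 = √(2 * a) := by simp [starkξ, hθ]
  have h2 : starkη a v 0 = 0 := by simp [starkη, starkφ_zero ha hv]
  have h3 : starkP a v 0 = 0 := by simp [starkP, hθ]
  have h4 : starkS a v 0 = v * √(2 * a) := by
    simp only [starkS, starkφ_zero ha hv, starkB, Real.cos_zero, Real.sin_zero]
    norm_num
    field_simp
  have hne : starkξ a v 0 ^ 2 + starkη a v 0 ^ 2 ≠ 0 := by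
    rw [h1, hs, h2]; positivity
  refine ⟨?_, ?_, ?_, ?_⟩
  · rw [starkX, starkTime_symm_zero, h1, h2, hs]; ring
  · rw [starkY, starkTime_symm_zero, h2, mul_zero]
  · rw [deriv_starkX ha hv (starkTime_symm_zero ha hv) hne, h2, h3]; simp
  · rw [deriv_starkY ha hv (starkTime_symm_zero ha hv) hne, h1, h2, h4, hs]
    field_simp
    rw [hs]; ring

end

/-! ### Orbits of types `A` and `B` among the explicit ones -/

section
variable {a v : ℝ}

theorem starkφ_eq_iff (ha : 0 < a) (hv : v ^ 2 < 2 / a - 2 * a) {u : ℝ} {n : ℕ} :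
    starkφ a v u = n * Real.pi ↔ u = 2 * n * starkL a v := by
  have h := starkφ_add ha hv 0 n
  rw [starkφ_zero ha hv, zero_add, zero_add] at h
  rw [← h]
  exact (starkφ_strictMono ha hv).injective.eq_iff

theorem starkφ_eq_half_iff (ha : 0 < a) (hv : v ^ 2 < 2 / a - 2 * a) {u : ℝ} {n : ℕ} :
    starkφ a v u = Real.pi / 2 + n * Real.pi ↔ u = (2 * n + 1) * starkL a v := by
  have h := starkφ_add ha hv (starkL a v) n
  rw [starkφ_L ha hv] at h
  rw [← h, (starkφ_strictMono ha hv).injective.eq_iff]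
  constructor <;> intro h' <;> linarith

/-- As long as ξ > 0, y = ξη vanishes only with η, and then x = ξ²/2. So the negative axis cannot be
reached before the first zero of ξ. -/
theorem starkX_pos_of_starkY_eq_zero (ha : 0 < a) (hv : v ^ 2 < 2 / a - 2 * a) {t : ℝ}
    (ht : t ∈ Ioo (starkTime ha hv (-starkK a v)) (starkT ha hv)) (hy : starkY ha hv t = 0) :
    0 < starkX ha hv t := by
  have h := starkξ_comp_pos ha hv ht
  rw [starkY, mul_eq_zero, or_iff_right h.ne'] at hy
  rw [starkX, hy]
  have := pow_pos h 2
  linarith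

theorem starkTime_symm_T (ha : 0 < a) (hv : v ^ 2 < 2 / a - 2 * a) :
    (starkTime ha hv).symm (starkT ha hv) = starkK a v :=
  (starkTime ha hv).symm_apply_apply _

theorem starkX_T (ha : 0 < a) (hv : v ^ 2 < 2 / a - 2 * a) :
    starkX ha hv (starkT ha hv) = -starkη a v (starkK a v) ^ 2 / 2 := by
  rw [starkX, starkTime_symm_T, starkξ_K ha hv]; ring

theorem starkY_T (ha : 0 < a) (hv : v ^ 2 < 2 / a - 2 * a) :
    starkY ha hv (starkT ha hv) = 0 := by
  rw [starkY, starkTime_symm_T, starkξ_K ha hv, zero_mul]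

/-- Crossings correspond to φ = nπ with 1 ≤ n ≤ k. The upper bound on φ may be an equality: the zero
of η with n = k + 1 then falls at the end time itself, which is not counted. This is the type B
case. -/
theorem encard_onPosXAxis (ha : 0 < a) (hv : v ^ 2 < 2 / a - 2 * a) (hv0 : v ≠ 0) {k : ℕ}
    (h1 : k * Real.pi < starkφ a v (starkK a v))
    (h2 : starkφ a v (starkK a v) ≤ (k + 1) * Real.pi) :
    {t ∈ Ioo 0 (starkT ha hv) | OnPosXAxis (starkX ha hv) (starkY ha hv) t}.encard = k := by
  have hm := starkφ_strictMono ha hv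
  have hL := starkL_pos ha hv
  have key : {t ∈ Ioo 0 (starkT ha hv) | OnPosXAxis (starkX ha hv) (starkY ha hv) t} =
      (fun n : ℕ => starkTime ha hv (2 * n * starkL a v)) '' (Finset.Icc 1 k : Finset ℕ) := by
    ext t
    constructor
    · rintro ⟨⟨ht0, htT⟩, -, hy⟩
      have htI : t ∈ Ioo (starkTime ha hv (-starkK a v)) (starkT ha hv) :=
        ⟨(starkTime_neg_K_neg ha hv).trans ht0, htT⟩
      rw [starkY, mul_eq_zero, or_iff_right (starkξ_comp_pos ha hv htI).ne',
        starkη_eq_zero_iff ha hv hv0, Real.sin_eq_zero_iff] at hy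
      obtain ⟨n, hn⟩ := hy
      have hpos : 0 < starkφ a v ((starkTime ha hv).symm t) := by
        rw [← starkφ_zero ha hv]
        refine hm ?_
        rw [← starkTime_symm_zero ha hv]
        exact (starkTime ha hv).symm.strictMono ht0
      have hlt := hm (starkTime_symm_mem ha hv htI).2
      rw [← hn] at hpos hlt
      have hn0 : 0 < n := by
        have := pos_of_mul_pos_left hpos Real.pi_pos.le
        exact_mod_cast this
      have hnk : n < k + 1 := by
        have := lt_of_mul_lt_mul_right (hlt.trans_le h2) Real.pi_pos.le
        exact_mod_cast this
      lift n to ℕ using hn0.le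
      refine ⟨n, by simp; omega, ?_⟩
      have := (starkφ_eq_iff ha hv (n := n)).1 (by rw [← hn]; simp)
      simp only [← this, OrderIso.apply_symm_apply]
    · rintro ⟨n, hn, rfl⟩
      rw [Finset.coe_Icc] at hn
      have hn1 : (1 : ℝ) ≤ n := by exact_mod_cast hn.1
      have hn2 : (n : ℝ) ≤ k := by exact_mod_cast hn.2
      have hφ : starkφ a v (2 * n * starkL a v) = n * Real.pi := (starkφ_eq_iff ha hv).2 rfl
      have hu0 : 0 < 2 * n * starkL a v := by positivity
      have huK : 2 * n * starkL a v < starkK a v := by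
        rw [← hm.lt_iff_lt, hφ]
        refine lt_of_le_of_lt ?_ h1
        exact mul_le_mul_of_nonneg_right hn2 Real.pi_pos.le
      have hy : starkY ha hv (starkTime ha hv (2 * n * starkL a v)) = 0 := by
        rw [starkY, OrderIso.symm_apply_apply, (starkη_eq_zero_iff ha hv hv0).2, mul_zero]
        rw [hφ, Real.sin_nat_mul_pi]
      have h0 : 0 < starkTime ha hv (2 * n * starkL a v) := by
        rw [← starkTime_zero ha hv]
        exact (starkTime ha hv).strictMono hu0
      have hT := (starkTime ha hv).strictMono huK
      exact ⟨⟨h0, hT⟩, starkX_pos_of_starkY_eq_zero ha hv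
        ⟨(starkTime_neg_K_neg ha hv).trans h0, hT⟩ hy, hy⟩
  rw [key, InjOn.encard_image, Set.encard_coe_eq_coe_finsetCard, Nat.card_Icc,
    Nat.add_sub_cancel]
  intro m _ n _ hmn
  have := (starkTime ha hv).injective hmn
  have h3 : (m : ℝ) = n := by
    have := mul_right_cancel₀ hL.ne' this
    linarith
  exact_mod_cast h3

theorem isOrbitB_stark (ha : 0 < a) (hv : v ^ 2 < 2 / a - 2 * a) (hv0 : v ≠ 0) {k : ℕ}
    (hK : starkK a v = 2 * (k + 1) * starkL a v) :
    IsOrbitB a v k (starkX ha hv) (starkY ha hv) := by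
  have hφ : starkφ a v (starkK a v) = (k + 1) * Real.pi := by
    have := (starkφ_eq_iff ha hv (u := starkK a v) (n := k + 1)).2 (by rw [hK]; push_cast; ring)
    rw [this]; push_cast; ring
  have hη : starkη a v (starkK a v) = 0 := by
    rw [starkη_eq_zero_iff ha hv hv0, hφ]
    exact_mod_cast Real.sin_nat_mul_pi (k + 1)
  refine ⟨starkTime ha hv (-starkK a v), starkT ha hv, starkTime_neg_K_neg ha hv,
    starkT_pos ha hv, isStarkSolutionOn_Ioo ha hv, startsFrom_stark ha hv, ?_, ?_,
    encard_onPosXAxis ha hv hv0 ?_ hφ.le⟩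
  · refine ((continuous_starkX ha hv).tendsto' (starkT ha hv) 0 ?_).mono_left inf_le_left
    rw [starkX_T, hη]; simp
  · exact ((continuous_starkY ha hv).tendsto' (starkT ha hv) 0 (starkY_T ha hv)).mono_left
      inf_le_left
  · rw [hφ]
    linarith [Real.pi_pos]

/-- An advance of 2K adds π to θ and the odd multiple (2k+1)π to φ, so ξ and η both change sign
while x, y and the time density are unchanged. At K itself ξ = 0 and cos φ = 0, hence s = 0, which
makes the meeting perpendicular. -/
theorem isOrbitA_stark (ha : 0 < a) (hv : v ^ 2 < 2 / a - 2 * a) (hv0 : v ≠ 0) {k : ℕ}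
    (hK : starkK a v = (2 * k + 1) * starkL a v) :
    IsOrbitA a v k (starkX ha hv) (starkY ha hv) := by
  have hφ : starkφ a v (starkK a v) = Real.pi / 2 + k * Real.pi := (starkφ_eq_half_iff ha hv).2 hK
  have hcos : Real.cos (starkφ a v (starkK a v)) = 0 := by
    rw [hφ, Real.cos_add_nat_mul_pi, Real.cos_pi_div_two, mul_zero]
  have hη : starkη a v (starkK a v) ≠ 0 := by
    rw [Ne, starkη_eq_zero_iff ha hv hv0]
    intro h
    have := Real.sin_sq_add_cos_sq (starkφ a v (starkK a v))
    rw [h, hcos] at this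
    norm_num at this
  have hξper : ∀ u, starkξ a v (u + 2 * starkK a v) = -starkξ a v u := fun u => by
    rw [starkξ, starkθ_add ha hv, Real.cos_add_pi, mul_neg, starkξ]
  have hηper : ∀ u, starkη a v (u + 2 * starkK a v) = -starkη a v u := fun u => by
    have := starkφ_add ha hv u (2 * k + 1)
    push_cast at this
    rw [starkη, hK, ← mul_assoc, this, starkη]
    have h2 := Real.sin_add_nat_mul_pi (starkφ a v u) (2 * k + 1)
    push_cast at h2
    rw [h2, Odd.neg_one_pow ⟨k, rfl⟩]
    ring
  have hρper : Function.Periodic (fun u => starkξ a v u ^ 2 + starkη a v u ^ 2)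
      (2 * starkK a v) := fun u => by
    simp only [hξper, hηper, neg_sq]
  have hKpos := starkK_pos ha hv
  -- By periodicity it is enough to look at (-K, K]: inside ξ > 0, and at K itself η ≠ 0.
  have hne : ∀ u, starkξ a v u ^ 2 + starkη a v u ^ 2 ≠ 0 := fun u => by
    obtain ⟨y, hy, hyu⟩ := hρper.exists_mem_Ioc (by positivity) u (-starkK a v)
    rw [hyu]
    rcases hy.2.lt_or_eq with h | h
    · have := starkξ_pos ha hv (u := y) ⟨hy.1, by linarith⟩
      positivity
    · have : y = starkK a v := by linarith
      rw [this]
      positivity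
  have htime : ∀ u, starkTime ha hv (u + 2 * starkK a v) =
      starkTime ha hv u + starkTime ha hv (2 * starkK a v) := fun u => by
    have hc : Continuous fun u => starkξ a v u ^ 2 + starkη a v u ^ 2 :=
      ((isRegularizedOrbit_stark ha hv).continuous_ξ.pow 2).add
        ((isRegularizedOrbit_stark ha hv).continuous_η.pow 2)
    have h := hρper.intervalIntegral_add_eq u 0
    rw [zero_add] at h
    change physicalTime _ _ _ = physicalTime _ _ _ + physicalTime _ _ _
    unfold physicalTime
    rw [← h, intervalIntegral.integral_add_adjacent_intervals] <;>
      exact hc.intervalIntegrable _ _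
  have hσ : ∀ t, (starkTime ha hv).symm (t + starkTime ha hv (2 * starkK a v)) =
      (starkTime ha hv).symm t + 2 * starkK a v := fun t => by
    rw [OrderIso.symm_apply_eq, htime, OrderIso.apply_symm_apply]
  refine ⟨isStarkSolutionOn_of_ne ha hv isOpen_univ fun t _ => hne _, startsFrom_stark ha hv,
    ⟨starkTime ha hv (2 * starkK a v), ?_, fun t => ?_, fun t => ?_⟩, starkT ha hv,
    starkT_pos ha hv, fun t ht hneg => ?_, ⟨?_, starkY_T ha hv⟩, ?_, ?_,
    encard_onPosXAxis ha hv hv0 ?_ ?_⟩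
  · rw [← starkTime_zero ha hv]
    exact (starkTime ha hv).strictMono (by positivity)
  · simp only [starkX, hσ, hξper, hηper, neg_sq]
  · simp only [starkY, hσ, hξper, hηper, neg_mul_neg]
  · exact lt_asymm hneg.1 (starkX_pos_of_starkY_eq_zero ha hv
      ⟨(starkTime_neg_K_neg ha hv).trans_le ht.1, ht.2⟩ hneg.2)
  · rw [starkX_T]
    have : 0 < starkη a v (starkK a v) ^ 2 := by positivity
    linarith
  · rw [deriv_starkX ha hv (starkTime_symm_T ha hv) (hne _), starkξ_K ha hv, starkS, hcos]
    simp
  · rw [deriv_starkY ha hv (starkTime_symm_T ha hv) (hne _), starkξ_K ha hv]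
    have hp : starkP a v (starkK a v) ≠ 0 := fun h => by
      have := starkP_sq ha hv (starkK a v)
      rw [h, starkξ_K ha hv] at this
      have := starkGap_pos hv
      have : 0 < 2 * a * (starkGap a v + 2 * a) := by positivity
      linarith
    have : (0 : ℝ) ^ 2 + starkη a v (starkK a v) ^ 2 ≠ 0 := by positivity
    rw [zero_mul, add_zero]
    exact div_ne_zero (mul_ne_zero hp hη) this
  · rw [hφ]; linarith [Real.pi_pos]
  · rw [hφ]; linarith [Real.pi_pos]

end

/-! ### Uniqueness and first integrals -/

/-- The Stark vector field on phase space. -/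
noncomputable def starkField (z : ℝ × ℝ × ℝ × ℝ) : ℝ × ℝ × ℝ × ℝ :=
  (z.2.2.1, z.2.2.2, -z.1 / √(z.1 ^ 2 + z.2.1 ^ 2) ^ 3 + 1,
    -z.2.1 / √(z.1 ^ 2 + z.2.1 ^ 2) ^ 3)

theorem sq_add_sq_pos_of_ne {x y : ℝ} (h : ¬ (x = 0 ∧ y = 0)) : 0 < x ^ 2 + y ^ 2 := by
  rcases not_and_or.1 h with h | h <;> positivity

theorem contDiffAt_starkField {z : ℝ × ℝ × ℝ × ℝ} (hz : ¬ (z.1 = 0 ∧ z.2.1 = 0)) :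
    ContDiffAt ℝ 1 starkField z := by
  have h0 := sq_add_sq_pos_of_ne hz
  have hne : z.1 ^ 2 + z.2.1 ^ 2 ≠ 0 := h0.ne'
  have hr : √(z.1 ^ 2 + z.2.1 ^ 2) ^ 3 ≠ 0 := by positivity
  have h3 : ContDiffAt ℝ 1 (fun z : ℝ × ℝ × ℝ × ℝ => √(z.1 ^ 2 + z.2.1 ^ 2) ^ 3) z := by
    fun_prop (disch := assumption)
  have h1 : ContDiffAt ℝ 1 (fun z : ℝ × ℝ × ℝ × ℝ => -z.1) z := by fun_prop
  have h2 : ContDiffAt ℝ 1 (fun z : ℝ × ℝ × ℝ × ℝ => -z.2.1) z := by fun_prop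
  have h4 := (h1.div h3 hr).add (contDiffAt_const (c := (1 : ℝ)))
  have h5 := h2.div h3 hr
  have h6 : ContDiffAt ℝ 1 (fun z : ℝ × ℝ × ℝ × ℝ => z.2.2.1) z := by fun_prop
  have h7 : ContDiffAt ℝ 1 (fun z : ℝ × ℝ × ℝ × ℝ => z.2.2.2) z := by fun_prop
  exact h6.prodMk (h7.prodMk (h4.prodMk h5))

namespace IsStarkSolutionOn

theorem mono {x y : ℝ → ℝ} {I J : Set ℝ} (H : IsStarkSolutionOn x y J) (h : I ⊆ J) :
    IsStarkSolutionOn x y I :=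
  ⟨fun t ht => H.1 t (h ht), fun t ht => H.2 t (h ht), fun t ht => H.3 t (h ht),
    fun t ht => H.4 t (h ht), fun t ht => H.5 t (h ht)⟩

theorem hasDerivAt_phase {x y : ℝ → ℝ} {I : Set ℝ} (H : IsStarkSolutionOn x y I) {t : ℝ}
    (ht : t ∈ I) : HasDerivAt (fun t => (x t, y t, deriv x t, deriv y t))
      (starkField (x t, y t, deriv x t, deriv y t)) t :=
  (H.differentiableAt_x t ht).hasDerivAt.prodMk <| (H.differentiableAt_y t ht).hasDerivAt.prodMk <|
    (H.accel_x t ht).prodMk (H.accel_y t ht)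

/-- The field is locally Lipschitz away from the origin, so agreement at one time spreads to a
neighbourhood. The set of local agreement is therefore open and relatively closed in a connected
interval. -/
theorem eqOn_phase {x y x' y' : ℝ → ℝ} {S T t₀ : ℝ} (H : IsStarkSolutionOn x y (Ioo S T))
    (H' : IsStarkSolutionOn x' y' (Ioo S T)) (ht₀ : t₀ ∈ Ioo S T)
    (h₀ : (x t₀, y t₀, deriv x t₀, deriv y t₀) = (x' t₀, y' t₀, deriv x' t₀, deriv y' t₀)) :
    EqOn (fun t => (x t, y t, deriv x t, deriv y t))
      (fun t => (x' t, y' t, deriv x' t, deriv y' t)) (Ioo S T) := by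
  set f := fun t => (x t, y t, deriv x t, deriv y t) with hf
  set g := fun t => (x' t, y' t, deriv x' t, deriv y' t) with hg
  have hfd : ∀ t ∈ Ioo S T, HasDerivAt f (starkField (f t)) t := fun t ht => H.hasDerivAt_phase ht
  have hgd : ∀ t ∈ Ioo S T, HasDerivAt g (starkField (g t)) t :=
    fun t ht => H'.hasDerivAt_phase ht
  have local_eq : ∀ t ∈ Ioo S T, f t = g t → f =ᶠ[𝓝 t] g := by
    intro t ht heq
    obtain ⟨K, s, hs, hlip⟩ :=
      (contDiffAt_starkField (z := f t) (H.ne_origin t ht)).exists_lipschitzOnWith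
    have hI := isOpen_Ioo.mem_nhds ht
    refine ODE_solution_unique_of_eventually (v := fun _ => starkField) (s := fun _ => s) (K := K)
      (Eventually.of_forall fun _ => hlip) ?_ ?_ heq
    · filter_upwards [hI, (hfd t ht).continuousAt hs] with w hw hws using ⟨hfd w hw, hws⟩
    · have := (hgd t ht).continuousAt (heq ▸ hs)
      filter_upwards [hI, this] with w hw hws using ⟨hgd w hw, hws⟩
  have hsub : Ioo S T ⊆ {t | f =ᶠ[𝓝 t] g} := by
    refine isPreconnected_Ioo.subset_of_closure_inter_subset isOpen_setOfPred_eventually_nhds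
      ⟨t₀, ht₀, local_eq t₀ ht₀ h₀⟩ ?_
    rintro t ⟨htc, ht⟩
    refine local_eq t ht ?_
    have hne : (𝓝[{t | f =ᶠ[𝓝 t] g}] t).NeBot := mem_closure_iff_nhdsWithin_neBot.1 htc
    refine tendsto_nhds_unique (l := 𝓝[{t | f =ᶠ[𝓝 t] g}] t) ((hfd t ht).continuousAt.mono_left inf_le_left)
      (((hgd t ht).continuousAt.tendsto.mono_left inf_le_left).congr' ?_)
    filter_upwards [self_mem_nhdsWithin] with w hw using hw.self_of_nhds.symm
  exact fun t ht => (hsub ht).self_of_nhds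

variable {x y : ℝ → ℝ}

theorem hasDerivAt_radius {I : Set ℝ} (H : IsStarkSolutionOn x y I) {t : ℝ} (ht : t ∈ I) :
    HasDerivAt (fun t => √(x t ^ 2 + y t ^ 2))
      ((x t * deriv x t + y t * deriv y t) / √(x t ^ 2 + y t ^ 2)) t := by
  have h0 := sq_add_sq_pos_of_ne (H.ne_origin t ht)
  refine ((((H.differentiableAt_x t ht).hasDerivAt.pow 2).add
    ((H.differentiableAt_y t ht).hasDerivAt.pow 2)).sqrt h0.ne').congr_deriv ?_
  have := (Real.sqrt_pos.2 h0).ne'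
  simp only [Pi.add_apply, Pi.pow_apply]
  field_simp
  push_cast
  ring

theorem radius_pos {I : Set ℝ} (H : IsStarkSolutionOn x y I) {t : ℝ} (ht : t ∈ I) :
    0 < √(x t ^ 2 + y t ^ 2) := Real.sqrt_pos.2 (sq_add_sq_pos_of_ne (H.ne_origin t ht))

theorem energy_eq (H : IsStarkSolutionOn x y univ) {a v : ℝ} (ha : 0 < a)
    (h0 : StartsFrom x y a v) (t : ℝ) :
    (deriv x t ^ 2 + deriv y t ^ 2) / 2 - 1 / √(x t ^ 2 + y t ^ 2) - x t =
      v ^ 2 / 2 - 1 / a - a := by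
  have hd : ∀ t, HasDerivAt (fun t => (deriv x t ^ 2 + deriv y t ^ 2) / 2 -
      1 / √(x t ^ 2 + y t ^ 2) - x t) 0 t := fun t => by
    have ht := mem_univ t
    have hr := H.radius_pos ht
    refine (((((H.accel_x t ht).pow 2).add ((H.accel_y t ht).pow 2)).div_const 2).sub
      ((hasDerivAt_const t (1 : ℝ)).div (H.hasDerivAt_radius ht) hr.ne') |>.sub
      (H.differentiableAt_x t ht).hasDerivAt).congr_deriv ?_
    generalize √(x t ^ 2 + y t ^ 2) = r at *
    field_simp
    push_cast
    ring
  have hc := is_const_of_deriv_eq_zero (fun t => (hd t).differentiableAt) (fun t => (hd t).deriv)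
    t 0
  rw [hc, h0.1, h0.2.1, h0.2.2.1, h0.2.2.2]
  simp [Real.sqrt_sq ha.le]

/-- The generalized Runge–Lenz integral. -/
theorem lenz_eq (H : IsStarkSolutionOn x y univ) {a v : ℝ} (ha : 0 < a)
    (h0 : StartsFrom x y a v) (t : ℝ) :
    x t / √(x t ^ 2 + y t ^ 2) - deriv y t * (x t * deriv y t - y t * deriv x t) - y t ^ 2 / 2 =
      1 - a * v ^ 2 := by
  have hd : ∀ t, HasDerivAt (fun t => x t / √(x t ^ 2 + y t ^ 2) -
      deriv y t * (x t * deriv y t - y t * deriv x t) - y t ^ 2 / 2) 0 t := fun t => by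
    have ht := mem_univ t
    have hr := H.radius_pos ht
    have hx := (H.differentiableAt_x t ht).hasDerivAt
    have hy := (H.differentiableAt_y t ht).hasDerivAt
    refine (((hx.div (H.hasDerivAt_radius ht) hr.ne').sub ((H.accel_y t ht).mul
      ((hx.mul (H.accel_y t ht)).sub (hy.mul (H.accel_x t ht))))).sub
      ((hy.pow 2).div_const 2)).congr_deriv ?_
    have hsq := Real.sq_sqrt (sq_add_sq_pos_of_ne (H.ne_origin t ht)).le
    simp only [Pi.sub_apply, Pi.mul_apply]
    generalize √(x t ^ 2 + y t ^ 2) = r at *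
    field_simp
    push_cast
    simp only [pow_one]
    linear_combination (2 * deriv x t) * hsq
  have hc := is_const_of_deriv_eq_zero (fun t => (hd t).differentiableAt) (fun t => (hd t).deriv)
    t 0
  rw [hc, h0.1, h0.2.1, h0.2.2.1, h0.2.2.2]
  simp [Real.sqrt_sq ha.le, ha.ne']
  ring

/-- The first-order equation of `w = r + x` in squared form. -/
theorem sq_deriv_radius_add (H : IsStarkSolutionOn x y univ) {a v : ℝ} (ha : 0 < a)
    (h0 : StartsFrom x y a v) (t : ℝ) :
    ((√(x t ^ 2 + y t ^ 2) + x t) * deriv x t + y t * deriv y t) ^ 2 =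
      (√(x t ^ 2 + y t ^ 2) + x t) * ((√(x t ^ 2 + y t ^ 2) + x t - 2 * a) *
        (√(x t ^ 2 + y t ^ 2) + x t - (2 / a - v ^ 2))) := by
  have hr := H.radius_pos (mem_univ t)
  have hE := H.energy_eq ha h0 t
  have hA := H.lenz_eq ha h0 t
  have hsq := Real.sq_sqrt (sq_add_sq_pos_of_ne (H.ne_origin t (mem_univ t))).le
  generalize √(x t ^ 2 + y t ^ 2) = r at *
  -- The roots 2a and 2/a - v² belong to the quadratic with coefficients 2h and 2(1 + A), where h is
  -- the energy and A the Runge–Lenz constant; both can then be replaced by their values at time t.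
  have h1 : (r + x t - 2 * a) * (r + x t - (2 / a - v ^ 2)) =
      (r + x t) ^ 2 + 2 * (v ^ 2 / 2 - 1 / a - a) * (r + x t) + 2 * (1 + (1 - a * v ^ 2)) := by
    field_simp; ring
  rw [h1, ← hE, ← hA]
  have hi : r⁻¹ * r = 1 := inv_mul_cancel₀ hr.ne'
  simp only [div_eq_mul_inv, one_mul]
  linear_combination (-(r + x t) - deriv y t ^ 2) * hsq + 2 * (r + x t) * hi

end IsStarkSolutionOn

/-! ### Every orbit of type `A` is one of the explicit orbits -/

namespace IsOrbitA

variable {a v : ℝ} {k : ℕ} {x y : ℝ → ℝ}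

/-- For v = 0 the Runge–Lenz integral on the negative axis gives ẏ²/2 = 1/r. The energy there is
then ẋ²/2 - x > 0, whereas initially it is -1/a - a < 0. -/
theorem velocity_ne_zero (ha : 0 < a) (H : IsOrbitA a v k x y) : v ≠ 0 := by
  rintro rfl
  obtain ⟨hsol, h0, -, T, -, -, ⟨hx, hy⟩, -, -, -⟩ := H
  have hE := hsol.energy_eq ha h0 T
  have hA := hsol.lenz_eq ha h0 T
  have hr : √(x T ^ 2 + y T ^ 2) = -x T := by
    rw [hy, ← neg_sq (x T)]
    simpa using Real.sqrt_sq (neg_nonneg.2 hx.le)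
  rw [hr, hy] at hA
  rw [hr] at hE
  have h1 : x T / -x T = -1 := by rw [div_neg, div_self hx.ne]
  rw [h1] at hA
  have h2 : 1 / -x T = deriv y T ^ 2 / 2 := by
    rw [div_eq_iff (by linarith)]
    linear_combination (-1 / 2) * hA
  rw [h2] at hE
  have : 0 < 1 / a := by positivity
  nlinarith [sq_nonneg (deriv x T)]

/-- The quantity w = r + x must descend from 2a to 0, the value on the negative axis. Above the
critical speed the square (rẇ)² would be negative for w just below 2a. -/
theorem velocity_sq_le (ha : 0 < a) (H : IsOrbitA a v k x y) : v ^ 2 ≤ 2 / a - 2 * a := by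
  obtain ⟨hsol, h0, -, T, hT, -, ⟨hx, hy⟩, -, -, -⟩ := H
  by_contra! hv
  have hc : Continuous fun t => √(x t ^ 2 + y t ^ 2) + x t :=
    continuous_iff_continuousAt.2 fun t => (hsol.hasDerivAt_radius (mem_univ t)).continuousAt.add
      (hsol.differentiableAt_x t (mem_univ t)).continuousAt
  have hw0 : √(x 0 ^ 2 + y 0 ^ 2) + x 0 = 2 * a := by
    rw [h0.1, h0.2.1]
    simp [Real.sqrt_sq ha.le]
    ring
  have hwT : √(x T ^ 2 + y T ^ 2) + x T = 0 := by
    rw [hy, ← neg_sq (x T)]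
    simp [Real.sqrt_sq_eq_abs, abs_of_neg hx]
  have hM : max (2 / a - v ^ 2) 0 < 2 * a := max_lt (by linarith) (by positivity)
  have hM1 := le_max_left (2 / a - v ^ 2) 0
  have hM2 := le_max_right (2 / a - v ^ 2) 0
  obtain ⟨t, -, ht⟩ := intermediate_value_Icc' hT.le hc.continuousOn
    (show (max (2 / a - v ^ 2) 0 + 2 * a) / 2 ∈ Icc _ _ by
      simp only [hw0, hwT]; constructor <;> linarith)
  simp only at ht
  have hsq := hsol.sq_deriv_radius_add ha h0 t
  rw [ht] at hsq
  generalize max (2 / a - v ^ 2) 0 = M at *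
  have h1 : 0 < (M + 2 * a) / 2 := by linarith
  have h2 : (M + 2 * a) / 2 - 2 * a < 0 := by linarith
  have h3 : 0 < (M + 2 * a) / 2 - (2 / a - v ^ 2) := by linarith
  have := mul_neg_of_pos_of_neg h1 (mul_neg_of_neg_of_pos h2 h3)
  rw [← hsq] at this
  exact absurd this (not_lt.2 (sq_nonneg _))

/-- At the critical speed 2a is a double root, so |ẇ| is bounded by a multiple of |w - 2a|. A
Grönwall argument keeps w at 2a, and it never reaches 0. -/
theorem velocity_sq_ne (ha : 0 < a) (H : IsOrbitA a v k x y) : v ^ 2 ≠ 2 / a - 2 * a := by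
  obtain ⟨hsol, h0, -, T, hT, -, ⟨hx, hy⟩, -, -, -⟩ := H
  intro hv
  have hw0 : √(x 0 ^ 2 + y 0 ^ 2) + x 0 = 2 * a := by
    rw [h0.1, h0.2.1]
    simp [Real.sqrt_sq ha.le]
    ring
  have hwT : √(x T ^ 2 + y T ^ 2) + x T = 0 := by
    rw [hy, ← neg_sq (x T)]
    simp [Real.sqrt_sq_eq_abs, abs_of_neg hx]
  have hrc : Continuous fun t => √(x t ^ 2 + y t ^ 2) :=
    continuous_iff_continuousAt.2 fun t => (hsol.hasDerivAt_radius (mem_univ t)).continuousAt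
  -- The least radius δ on [0, T] supplies the Grönwall constant: w ≤ 2r gives w/r² ≤ 2/δ ≤ (2/δ +
  -- 1)².
  obtain ⟨t₀, -, hmin⟩ := isCompact_Icc.exists_isMinOn (nonempty_Icc.2 hT.le) hrc.continuousOn
  have hδ := hsol.radius_pos (mem_univ t₀)
  set δ := √(x t₀ ^ 2 + y t₀ ^ 2)
  have hd : ∀ t, HasDerivAt (fun t => √(x t ^ 2 + y t ^ 2) + x t - 2 * a)
      (((√(x t ^ 2 + y t ^ 2) + x t) * deriv x t + y t * deriv y t) / √(x t ^ 2 + y t ^ 2)) t :=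
    fun t => by
      have hr := hsol.radius_pos (mem_univ t)
      refine (((hsol.hasDerivAt_radius (mem_univ t)).add
        (hsol.differentiableAt_x t (mem_univ t)).hasDerivAt).sub_const (2 * a)).congr_deriv ?_
      field_simp
      ring
  have hzero := eq_zero_of_abs_deriv_le_mul_abs_self_of_eq_zero_right (a := 0) (b := T)
    (K := 2 / δ + 1) (fun t _ => (hd t).continuousAt.continuousWithinAt)
    (fun t _ => (hd t).hasDerivWithinAt) (by rw [hw0, sub_self]) (fun t ht => by
      have hr := hsol.radius_pos (mem_univ t)
      have hsq := hsol.sq_deriv_radius_add ha h0 t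
      have hδr : δ ≤ √(x t ^ 2 + y t ^ 2) := hmin (Ico_subset_Icc_self ht)
      have hxr : x t ≤ √(x t ^ 2 + y t ^ 2) :=
        Real.le_sqrt_of_sq_le (by nlinarith [sq_nonneg (y t)])
      rw [Real.norm_eq_abs, Real.norm_eq_abs, ← abs_of_pos (show 0 < 2 / δ + 1 by positivity),
        ← abs_mul]
      apply sq_le_sq.1
      rw [div_pow, hsq, mul_pow, show 2 / a - v ^ 2 = 2 * a by linarith, ← pow_two,
        mul_div_right_comm]
      refine mul_le_mul_of_nonneg_right ?_ (sq_nonneg _)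
      have h1 : (√(x t ^ 2 + y t ^ 2) + x t) / √(x t ^ 2 + y t ^ 2) ^ 2 ≤ 2 / δ := by
        generalize √(x t ^ 2 + y t ^ 2) = r at *
        rw [div_le_div_iff₀ (by positivity) hδ]
        nlinarith
      have h2 : 0 < 2 / δ := by positivity
      nlinarith) T (right_mem_Icc.2 hT.le)
  simp only [hwT] at hzero
  linarith

theorem velocity_sq_lt (ha : 0 < a) (H : IsOrbitA a v k x y) : v ^ 2 < 2 / a - 2 * a :=
  lt_of_le_of_ne (H.velocity_sq_le ha) (H.velocity_sq_ne ha)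

theorem starkK_eq (ha : 0 < a) (H : IsOrbitA a v k x y) :
    starkK a v = (2 * k + 1) * starkL a v := by
  have hv := H.velocity_sq_lt ha
  have hv0 := H.velocity_ne_zero ha
  obtain ⟨hsol, h0, -, T, hT, hfirst, hneg, hxT, -, hcard⟩ := H
  have hS := starkTime_neg_K_neg ha hv
  have hT' := starkT_pos ha hv
  have h0' := startsFrom_stark ha hv
  have heq := (hsol.mono (subset_univ _)).eqOn_phase (isStarkSolutionOn_Ioo ha hv) ⟨hS, hT'⟩ (by
    rw [h0.1, h0.2.1, h0.2.2.1, h0.2.2.2, h0'.1, h0'.2.1, h0'.2.2.1, h0'.2.2.2])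
  have hex : EqOn x (starkX ha hv) (Ioo (starkTime ha hv (-starkK a v)) (starkT ha hv)) :=
    fun t ht => (Prod.ext_iff.1 (heq ht)).1
  have hey : EqOn y (starkY ha hv) (Ioo (starkTime ha hv (-starkK a v)) (starkT ha hv)) :=
    fun t ht => (Prod.ext_iff.1 (Prod.ext_iff.1 (heq ht)).2).1
  have hedx : EqOn (deriv x) (deriv (starkX ha hv))
      (Ioo (starkTime ha hv (-starkK a v)) (starkT ha hv)) :=
    fun t ht => (Prod.ext_iff.1 (Prod.ext_iff.1 (Prod.ext_iff.1 (heq ht)).2).2).1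
  have hxc : Continuous x := continuous_iff_continuousAt.2 fun t =>
    (hsol.differentiableAt_x t (mem_univ t)).continuousAt
  have hyc : Continuous y := continuous_iff_continuousAt.2 fun t =>
    (hsol.differentiableAt_y t (mem_univ t)).continuousAt
  have hdxc : Continuous (deriv x) := continuous_iff_continuousAt.2 fun t =>
    (hsol.accel_x t (mem_univ t)).continuousAt
  have hcl : starkT ha hv ∈ closure (Ioo (starkTime ha hv (-starkK a v)) (starkT ha hv)) := by
    rw [closure_Ioo (hS.trans hT').ne]
    exact right_mem_Icc.2 (hS.trans hT').le
  have hxT' := hex.closure hxc (continuous_starkX ha hv) hcl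
  have hyT' := hey.closure hyc (continuous_starkY ha hv) hcl
  rw [starkX_T] at hxT'
  rw [starkY_T] at hyT'
  -- Otherwise the globally defined solution would collide at this time.
  have hη : starkη a v (starkK a v) ≠ 0 := fun h => hsol.ne_origin _ (mem_univ (starkT ha hv))
    ⟨by rw [hxT', h]; simp, hyT'⟩
  have hTT : T = starkT ha hv := by
    refine le_antisymm (not_lt.1 fun h => hfirst _ ⟨hT'.le, h⟩ ⟨?_, hyT'⟩) (not_lt.1 fun h => ?_)
    · rw [hxT']
      have : 0 < starkη a v (starkK a v) ^ 2 := by positivity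
      linarith
    · have hTI : T ∈ Ioo (starkTime ha hv (-starkK a v)) (starkT ha hv) := ⟨hS.trans hT, h⟩
      have := starkX_pos_of_starkY_eq_zero ha hv hTI (by rw [← hey hTI, hneg.2])
      rw [← hex hTI] at this
      exact lt_asymm this hneg.1
  subst hTT
  have R := isRegularizedOrbit_stark ha hv
  have hσ := (starkTime ha hv).symm.continuous
  -- Uniqueness only gives agreement before the endpoint. Clearing the denominator makes both sides
  -- continuous, so the identity passes to the closure, where ẋ = 0 and ξ = 0 leave ηs = 0.
  have hprod : EqOn
      (fun t => deriv x t * (starkξ a v ((starkTime ha hv).symm t) ^ 2 +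
        starkη a v ((starkTime ha hv).symm t) ^ 2))
      (fun t => starkξ a v ((starkTime ha hv).symm t) * starkP a v ((starkTime ha hv).symm t) -
        starkη a v ((starkTime ha hv).symm t) * starkS a v ((starkTime ha hv).symm t))
      (Ioo (starkTime ha hv (-starkK a v)) (starkT ha hv)) := fun t ht => by
    have hne : starkξ a v ((starkTime ha hv).symm t) ^ 2 +
        starkη a v ((starkTime ha hv).symm t) ^ 2 ≠ 0 := by
      have := starkξ_comp_pos ha hv ht
      positivity
    simp only
    rw [hedx ht, deriv_starkX ha hv rfl hne, div_mul_cancel₀ _ hne]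
  have hlim := hprod.closure
    (hdxc.mul (((R.continuous_ξ.comp hσ).pow 2).add ((R.continuous_η.comp hσ).pow 2)))
    (((R.continuous_ξ.comp hσ).mul (R.continuous_p.comp hσ)).sub
      ((R.continuous_η.comp hσ).mul (R.continuous_s.comp hσ))) hcl
  simp only [hxT, starkTime_symm_T, starkξ_K ha hv, zero_mul, zero_sub] at hlim
  have hs : starkS a v (starkK a v) = 0 := by
    have := neg_eq_zero.1 hlim.symm
    exact (mul_eq_zero.1 this).resolve_left hη
  have hΔ := Real.sqrt_pos.2 (elliptic_radicand_pos (starkQ_pos ha hv) (sq_nonneg (starkB a v))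
    (starkφ a v (starkK a v)))
  have hcos : Real.cos (starkφ a v (starkK a v)) = 0 := by
    rw [starkS] at hs
    exact (mul_eq_zero.1 ((mul_eq_zero.1 hs).resolve_left (starkB_ne_zero ha hv hv0))).resolve_right
      hΔ.ne'
  obtain ⟨j, hj⟩ := Real.cos_eq_zero_iff.1 hcos
  have hφpos : 0 < starkφ a v (starkK a v) := by
    rw [← starkφ_zero ha hv]
    exact starkφ_strictMono ha hv (starkK_pos ha hv)
  have hj0 : 0 ≤ j := by
    rw [hj] at hφpos
    have h1 : (0 : ℝ) < 2 * j + 1 := by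
      by_contra! hle
      nlinarith [Real.pi_pos]
    have h2 : (0 : ℤ) < 2 * j + 1 := by exact_mod_cast h1
    omega
  lift j to ℕ using hj0
  have hj' : starkφ a v (starkK a v) = Real.pi / 2 + j * Real.pi := by
    rw [hj]; push_cast; ring
  have hcount := encard_onPosXAxis ha hv hv0 (k := j) (by rw [hj']; linarith [Real.pi_pos])
    (by rw [hj']; linarith [Real.pi_pos])
  have hset : {t ∈ Ioo 0 (starkT ha hv) | OnPosXAxis x y t} =
      {t ∈ Ioo 0 (starkT ha hv) | OnPosXAxis (starkX ha hv) (starkY ha hv) t} := by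
    ext t
    refine and_congr_right fun ht => ?_
    have htI : t ∈ Ioo (starkTime ha hv (-starkK a v)) (starkT ha hv) := ⟨hS.trans ht.1, ht.2⟩
    rw [OnPosXAxis, OnPosXAxis, hex htI, hey htI]
  rw [hset, hcount] at hcard
  have hjk : j = k := by exact_mod_cast hcard
  rw [← hjk]
  exact (starkφ_eq_half_iff ha hv).1 hj'

end IsOrbitA

/-! ### The frequency ratio -/

/-- The ratio of the quarter-period of `ξ` to the half-period of `η`. -/
noncomputable def starkRatio (a v : ℝ) : ℝ := starkK a v / (2 * starkL a v)

theorem continuous_ellipticF_of_continuous {X : Type*} [TopologicalSpace X] {α β : X → ℝ}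
    (hα : Continuous α) (hβ : Continuous β) (hα0 : ∀ z, 0 < α z) (hβ0 : ∀ z, 0 ≤ β z) (c : ℝ) :
    Continuous fun z => ellipticF (α z) (β z) c := by
  refine intervalIntegral.continuous_parametric_intervalIntegral_of_continuous' ?_ 0 c
  have : ∀ w : X × ℝ, √(α w.1 + β w.1 * Real.sin w.2 ^ 2) ≠ 0 := fun w =>
    (Real.sqrt_pos.2 (elliptic_radicand_pos (hα0 w.1) (hβ0 w.1) w.2)).ne'
  unfold Function.uncurry
  fun_prop (disch := assumption)

theorem sq_lt_of_mem_Ioo {a v : ℝ} (h : v ∈ Ioo 0 √(2 / a - 2 * a)) :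
    v ^ 2 < 2 / a - 2 * a := (Real.lt_sqrt h.1.le).1 h.2

theorem continuousOn_starkRatio {a : ℝ} (ha : 0 < a) :
    ContinuousOn (starkRatio a) (Ioo 0 √(2 / a - 2 * a)) := by
  rw [continuousOn_iff_continuous_domRestrict]
  have hv : ∀ z : Ioo 0 √(2 / a - 2 * a), (z : ℝ) ^ 2 < 2 / a - 2 * a := fun z =>
    sq_lt_of_mem_Ioo z.2
  have hq : Continuous fun z : Ioo 0 √(2 / a - 2 * a) => starkQ a z := by
    unfold starkQ starkEnergy; fun_prop
  have hB : Continuous fun z : Ioo 0 √(2 / a - 2 * a) => starkB a z ^ 2 := by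
    have : ∀ z : Ioo 0 √(2 / a - 2 * a), √(starkQ a z) ≠ 0 := fun z =>
      (Real.sqrt_pos.2 (starkQ_pos ha (hv z))).ne'
    unfold starkB
    fun_prop (disch := assumption)
  have hK : Continuous fun z : Ioo 0 √(2 / a - 2 * a) => starkK a z :=
    continuous_ellipticF_of_continuous (by unfold starkGap; fun_prop) continuous_const
      (fun z => starkGap_pos (hv z)) (fun _ => by positivity) _
  have hL : Continuous fun z : Ioo 0 √(2 / a - 2 * a) => starkL a z :=
    continuous_ellipticF_of_continuous hq hB (fun z => starkQ_pos ha (hv z))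
      (fun _ => sq_nonneg _) _
  exact hK.div (continuous_const.mul hL) fun z =>
    (mul_pos two_pos (starkL_pos ha (hv z))).ne'

/-- A lower bound for the frequency ratio in terms of the ratio of radicand coefficients. -/
noncomputable def ratioBound (z : ℝ) : ℝ := Real.log (1 + √z * (Real.pi / 2)) / Real.pi

theorem ratioBound_mono {z w : ℝ} (h : z ≤ w) : ratioBound z ≤ ratioBound w := by
  have := Real.sqrt_le_sqrt h
  unfold ratioBound
  gcongr

theorem tendsto_ratioBound : Tendsto ratioBound atTop atTop := by
  refine Tendsto.atTop_div_const Real.pi_pos (Real.tendsto_log_atTop.comp ?_)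
  exact tendsto_atTop_add_const_left _ _ (Real.tendsto_sqrt_atTop.atTop_mul_const (by positivity))

/-- K is at least a logarithm over √(2a), and 2L ≤ π/√(2a) because Q ≥ 4a. The factors √(2a) cancel,
so the bound depends only on 2a/gap. -/
theorem ratioBound_le_starkRatio {a v : ℝ} (ha : 0 < a) (hv : v ^ 2 < 2 / a - 2 * a) :
    ratioBound (2 * a / starkGap a v) ≤ starkRatio a v := by
  have hg := starkGap_pos hv
  have hq := starkQ_pos ha hv
  have h2a : 0 < 2 * a := by positivity
  have hs := Real.sqrt_pos.2 h2a
  have hK : Real.log (1 + √(2 * a / starkGap a v) * (Real.pi / 2)) / √(2 * a) ≤ starkK a v :=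
    le_ellipticF hg h2a (by positivity)
  have hL : starkL a v ≤ Real.pi / 2 / √(starkQ a v) :=
    ellipticF_le hq (sq_nonneg _) (by positivity)
  have hsq : √(2 * a) ≤ √(starkQ a v) := Real.sqrt_le_sqrt (by
    have := four_mul_le_starkQ ha hv
    linarith)
  have hL' : 2 * starkL a v ≤ Real.pi / √(2 * a) := by
    have : Real.pi / 2 / √(starkQ a v) ≤ Real.pi / 2 / √(2 * a) := by gcongr
    have h3 : Real.pi / √(2 * a) = 2 * (Real.pi / 2 / √(2 * a)) := by ring
    linarith
  have hL0 := starkL_pos ha hv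
  have hlog : 0 ≤ Real.log (1 + √(2 * a / starkGap a v) * (Real.pi / 2)) :=
    Real.log_nonneg (by
      have : 0 ≤ √(2 * a / starkGap a v) * (Real.pi / 2) := by positivity
      linarith)
  calc ratioBound (2 * a / starkGap a v)
      = (Real.log (1 + √(2 * a / starkGap a v) * (Real.pi / 2)) / √(2 * a)) /
        (Real.pi / √(2 * a)) := by unfold ratioBound; field_simp
    _ ≤ starkK a v / (2 * starkL a v) := by
      have := (starkK_pos ha hv).le
      gcongr

theorem tendsto_starkRatio {a : ℝ} (ha : a ∈ Ioo (0 : ℝ) 1) :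
    Tendsto (starkRatio a) (𝓝[<] √(2 / a - 2 * a)) atTop := by
  have hpos : 0 < 2 / a - 2 * a := by
    have : 2 < 2 / a := by rw [lt_div_iff₀ ha.1]; linarith [ha.2]
    linarith [ha.2]
  have hV := Real.sqrt_pos.2 hpos
  have hmem : Ioo 0 √(2 / a - 2 * a) ∈ 𝓝[<] √(2 / a - 2 * a) := Ioo_mem_nhdsLT hV
  have hgap : Tendsto (starkGap a) (𝓝[<] √(2 / a - 2 * a)) (𝓝[>] 0) := by
    refine tendsto_nhdsWithin_iff.2 ⟨?_, ?_⟩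
    · have hc : Continuous (starkGap a) := by unfold starkGap; fun_prop
      refine (hc.tendsto' _ 0 ?_).mono_left inf_le_left
      rw [starkGap, Real.sq_sqrt hpos.le, sub_self]
    · filter_upwards [hmem] with v hv using starkGap_pos (sq_lt_of_mem_Ioo hv)
  have h1 : Tendsto (fun v => 2 * a / starkGap a v) (𝓝[<] √(2 / a - 2 * a)) atTop :=
    (tendsto_inv_nhdsGT_zero.comp hgap).const_mul_atTop (by linarith [ha.1] : 0 < 2 * a)
  refine tendsto_atTop_mono' _ ?_ (tendsto_ratioBound.comp h1)
  filter_upwards [hmem] with v hv using ratioBound_le_starkRatio ha.1 (sq_lt_of_mem_Ioo hv)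

/-- Only v² enters, so type A orbits with negative velocity are covered by the positive interval. -/
theorem starkRatio_abs (a v : ℝ) : starkRatio a |v| = starkRatio a v := by
  simp [starkRatio, starkK, starkL, starkGap, starkQ, starkEnergy, starkB, div_pow, mul_pow]

theorem starkRatio_eq_iff {a v : ℝ} (ha : 0 < a) (hv : v ^ 2 < 2 / a - 2 * a) {w : ℝ} :
    starkRatio a v = w ↔ starkK a v = 2 * w * starkL a v := by
  have := starkL_pos ha hv
  rw [starkRatio, div_eq_iff (by positivity)]
  constructor <;> intro h <;> linarith

theorem IsOrbitA.exists_ratio_eq {a v : ℝ} {k : ℕ} {x y : ℝ → ℝ} (ha : 0 < a)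
    (H : IsOrbitA a v k x y) : ∃ w ∈ Ioo 0 √(2 / a - 2 * a), starkRatio a w = k + 1 / 2 := by
  have hv := H.velocity_sq_lt ha
  refine ⟨|v|, ⟨abs_pos.2 (H.velocity_ne_zero ha), ?_⟩, ?_⟩
  · rwa [Real.lt_sqrt (abs_nonneg v), sq_abs]
  · rw [starkRatio_abs, starkRatio_eq_iff ha hv, H.starkK_eq ha]
    ring

/-! ### Last crossings -/

section
variable {W : ℝ → ℝ} {V : ℝ}

theorem exists_gt_eq_of_tendsto_atTop (hW : ContinuousOn W (Ioo 0 V))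
    (hlim : Tendsto W (𝓝[<] V) atTop) {u w : ℝ} (hu : u ∈ Ioo 0 V) (h : W u < w) :
    ∃ z ∈ Ioo 0 V, u < z ∧ W z = w := by
  obtain ⟨z, hz, hwz⟩ := ((Ioo_mem_nhdsLT hu.2 : Ioo u V ∈ 𝓝[<] V) |> fun h =>
    (eventually_mem_set.2 h).and (hlim.eventually_ge_atTop w)).exists
  have hsub : Icc u z ⊆ Ioo 0 V := fun t ht => ⟨hu.1.trans_le ht.1, ht.2.trans_lt hz.2⟩
  obtain ⟨t, ht, htw⟩ := intermediate_value_Icc hz.1.le (hW.mono hsub) ⟨h.le, hwz⟩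
  refine ⟨t, hsub ht, lt_of_le_of_ne ht.1 ?_, htw⟩
  rintro rfl
  exact h.ne htw

/-- The blow-up keeps the level set away from V. Cutting on the left at a known crossing u makes it
compact, whatever happens near 0. -/
theorem exists_isGreatest_crossing (hW : ContinuousOn W (Ioo 0 V))
    (hlim : Tendsto W (𝓝[<] V) atTop) {u w : ℝ} (hu : u ∈ Ioo 0 V) (h : W u = w) :
    ∃ z, IsGreatest {z ∈ Ioo 0 V | W z = w} z := by
  obtain ⟨c, hcV, hc⟩ := (mem_nhdsLT_iff_exists_Ioo_subset' hu.2).1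
    (hlim.eventually_gt_atTop w)
  have hle : ∀ z ∈ Ioo 0 V, W z = w → z ≤ c := fun z hz hzw => by
    by_contra! hcz
    exact (ne_of_gt (hc ⟨hcz, hz.2⟩ : w < W z)) hzw
  have hsub : Icc u c ⊆ Ioo 0 V := fun t ht => ⟨hu.1.trans_le ht.1, ht.2.trans_lt hcV⟩
  have hcomp : IsCompact (Icc u c ∩ W ⁻¹' {w}) :=
    isCompact_Icc.of_isClosed_subset
      ((hW.mono hsub).preimage_isClosed_of_isClosed isClosed_Icc isClosed_singleton)
      inter_subset_left
  obtain ⟨z, hz, hmax⟩ := hcomp.exists_isGreatest ⟨u, ⟨le_rfl, hle u hu h⟩, h⟩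
  refine ⟨z, ⟨hsub hz.1, hz.2⟩, fun t ht => ?_⟩
  rcases le_total t u with htu | htu
  · exact htu.trans hz.1.1
  · exact hmax ⟨⟨htu, hle t ht.1 ht.2⟩, ht.2⟩

/-- A continuous function blowing up at `V` has a last crossing of each level it attains; the last
crossings increase with the level and converge to `V`. -/
theorem exists_last_crossing (hV : 0 < V) (hW : ContinuousOn W (Ioo 0 V))
    (hlim : Tendsto W (𝓝[<] V) atTop) :
    ∃ b : ℝ → ℝ, (∀ w, (∃ u ∈ Ioo 0 V, W u = w) → b w ∈ Ioo 0 V ∧ W (b w) = w ∧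
      ∀ w' > w, b w < b w') ∧ Tendsto b atTop (𝓝 V) := by
  have hex : ∀ w, ∃ z, (∃ u ∈ Ioo 0 V, W u = w) → IsGreatest {z ∈ Ioo 0 V | W z = w} z := by
    intro w
    by_cases h : ∃ u ∈ Ioo 0 V, W u = w
    · obtain ⟨u, hu, huw⟩ := h
      obtain ⟨z, hz⟩ := exists_isGreatest_crossing hW hlim hu huw
      exact ⟨z, fun _ => hz⟩
    · exact ⟨0, fun h' => absurd h' h⟩
  choose b hb using hex
  -- A higher level is attained again to the right of `b w`, by the intermediate value theorem, so
  -- its last crossing lies further right.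
  refine ⟨b, fun w hw => ⟨(hb w hw).1.1, (hb w hw).1.2, fun w' hw' => ?_⟩, ?_⟩
  · obtain ⟨z, hz, hlt, hzw⟩ := exists_gt_eq_of_tendsto_atTop hW hlim (hb w hw).1.1
      ((hb w hw).1.2.trans_lt hw')
    exact hlt.trans_le ((hb w' ⟨z, hz, hzw⟩).2 ⟨hz, hzw⟩)
  · have key : ∀ c ∈ Ioo 0 V, ∀ w > W c, b w ∈ Ioo c V := fun c hc w hw => by
      obtain ⟨z, hz, hlt, hzw⟩ := exists_gt_eq_of_tendsto_atTop hW hlim hc hw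
      have := hb w ⟨z, hz, hzw⟩
      exact ⟨hlt.trans_le (this.2 ⟨hz, hzw⟩), this.1.1.2⟩
    refine tendsto_order.2 ⟨fun c hc => ?_, fun c hc => ?_⟩
    · have hm : max c (V / 2) ∈ Ioo 0 V :=
        ⟨(half_pos hV).trans_le (le_max_right _ _), max_lt hc (half_lt_self hV)⟩
      filter_upwards [eventually_gt_atTop (W (max c (V / 2)))] with w hw
      exact (le_max_left _ _).trans_lt (key _ hm w hw).1
    · filter_upwards [eventually_gt_atTop (W (V / 2))] with w hw
      exact (key _ ⟨half_pos hV, half_lt_self hV⟩ w hw).2.trans hc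

end

/-! ### The minimal index and the main theorem -/

/-- The least `k` such that the frequency ratio attains `k + 1 / 2`. -/
noncomputable def starkMinIndex (a : ℝ) : ℕ :=
  sInf {k : ℕ | ∃ w ∈ Ioo 0 √(2 / a - 2 * a), starkRatio a w = k + 1 / 2}

theorem sqrt_critical_pos {a : ℝ} (ha : a ∈ Ioo (0 : ℝ) 1) : 0 < √(2 / a - 2 * a) := by
  have : 2 < 2 / a := by rw [lt_div_iff₀ ha.1]; linarith [ha.2]
  exact Real.sqrt_pos.2 (by linarith [ha.2])

theorem starkMinIndex_spec {a : ℝ} (ha : a ∈ Ioo (0 : ℝ) 1) :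
    ∃ w ∈ Ioo 0 √(2 / a - 2 * a), starkRatio a w = starkMinIndex a + 1 / 2 := by
  refine Nat.sInf_mem (s := {k : ℕ | ∃ w ∈ Ioo 0 √(2 / a - 2 * a),
    starkRatio a w = k + 1 / 2}) ?_
  have hV := sqrt_critical_pos ha
  obtain ⟨k, hk⟩ := exists_nat_gt (starkRatio a (√(2 / a - 2 * a) / 2))
  obtain ⟨z, hz, -, hzk⟩ := exists_gt_eq_of_tendsto_atTop (continuousOn_starkRatio ha.1)
    (tendsto_starkRatio ha) (w := k + 1 / 2) ⟨half_pos hV, half_lt_self hV⟩ (by linarith)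
  exact ⟨k, z, hz, hzk⟩

/-- The gap is at most 2/a - 2a for every v, so the logarithmic bound holds uniformly in v and
diverges as a → 1. Since the ratio attains the minimal index plus 1/2, the index diverges too. -/
theorem tendsto_starkMinIndex : Tendsto starkMinIndex (𝓝[<] 1) atTop := by
  have hmem : Ioo (0 : ℝ) 1 ∈ 𝓝[<] (1 : ℝ) := Ioo_mem_nhdsLT one_pos
  have hcrit : ∀ a ∈ Ioo (0 : ℝ) 1, 0 < 2 / a - 2 * a := fun a ha => by
    have : 2 < 2 / a := by rw [lt_div_iff₀ ha.1]; linarith [ha.2]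
    linarith [ha.2]
  have hgap : Tendsto (fun a : ℝ => 2 / a - 2 * a) (𝓝[<] 1) (𝓝[>] 0) := by
    refine tendsto_nhdsWithin_iff.2 ⟨?_, ?_⟩
    · have hc : ContinuousAt (fun a : ℝ => 2 / a - 2 * a) 1 := by
        have : (1 : ℝ) ≠ 0 := one_ne_zero
        fun_prop (disch := assumption)
      have := hc.tendsto.mono_left (inf_le_left : 𝓝[<] (1 : ℝ) ≤ 𝓝 1)
      norm_num at this
      exact this
    · filter_upwards [hmem] with a ha using hcrit a ha
  have h1 : Tendsto (fun a : ℝ => 2 * a / (2 / a - 2 * a)) (𝓝[<] 1) atTop := by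
    have h2 : Tendsto (fun a : ℝ => 2 * a) (𝓝[<] 1) (𝓝 (2 * 1)) :=
      ((continuous_const.mul continuous_id).tendsto 1).mono_left inf_le_left
    exact h2.pos_mul_atTop (by norm_num) (tendsto_inv_nhdsGT_zero.comp hgap)
  rw [← tendsto_natCast_atTop_iff (R := ℝ)]
  refine tendsto_atTop_mono' _ ?_
    (tendsto_atTop_add_const_right _ (-(1 / 2) : ℝ) (tendsto_ratioBound.comp h1))
  filter_upwards [hmem] with a ha
  obtain ⟨w, hw, hwk⟩ := starkMinIndex_spec ha
  have hb := ratioBound_le_starkRatio ha.1 (sq_lt_of_mem_Ioo hw)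
  have hg := starkGap_pos (sq_lt_of_mem_Ioo hw)
  have hle : 2 * a / (2 / a - 2 * a) ≤ 2 * a / starkGap a w := by
    refine div_le_div_of_nonneg_left (by linarith [ha.1]) hg ?_
    unfold starkGap
    linarith [sq_nonneg w]
  have := ratioBound_mono hle
  simp only [Function.comp]
  linarith

theorem theorem2 :
    ∃ kp : ℝ → ℕ,
      (∀ a ∈ Ioo (0 : ℝ) 1,
        -- `kp a` is minimal: below it there is no orbit of type `A`
        (∀ k < kp a, ¬ ∃ (v : ℝ) (x y : ℝ → ℝ), IsOrbitA a v k x y) ∧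
        ∃ b b' : ℕ → ℝ,
          (∀ k ≥ kp a,
            0 < b k ∧ b k < b' k ∧ b' k < b (k + 1) ∧
            (∃ x y : ℝ → ℝ, IsOrbitA a (b k) k x y) ∧
            (∃ x y : ℝ → ℝ, IsOrbitB a (b' k) k x y)) ∧
          Tendsto b atTop (𝓝 √(2 / a - 2 * a)) ∧
          Tendsto b' atTop (𝓝 √(2 / a - 2 * a))) ∧
      Tendsto kp (𝓝[<] 1) atTop := by
  refine ⟨starkMinIndex, fun a ha => ⟨?_, ?_⟩, tendsto_starkMinIndex⟩
  · rintro k hk ⟨v, x, y, H⟩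
    exact Nat.notMem_of_lt_sInf hk (H.exists_ratio_eq ha.1)
  have hW := continuousOn_starkRatio ha.1
  have hlim := tendsto_starkRatio ha
  obtain ⟨c, hc, hclim⟩ := exists_last_crossing (sqrt_critical_pos ha) hW hlim
  obtain ⟨u, hu, huk⟩ := starkMinIndex_spec ha
  have hattained : ∀ w : ℝ, starkMinIndex a + 1 / 2 ≤ w →
      ∃ z ∈ Ioo 0 √(2 / a - 2 * a), starkRatio a z = w := fun w hw => by
    rcases hw.eq_or_lt with rfl | hlt
    · exact ⟨u, hu, huk⟩
    · obtain ⟨z, hz, -, hzw⟩ := exists_gt_eq_of_tendsto_atTop hW hlim hu (huk.trans_lt hlt)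
      exact ⟨z, hz, hzw⟩
  -- The levels k + 1/2 < k + 1 < k + 3/2 interlace, and last crossings increase with the level;
  -- this gives the ordering of the two sequences.
  refine ⟨fun k => c (k + 1 / 2), fun k => c (k + 1), fun k hk => ?_, ?_, ?_⟩
  · have hk' : (starkMinIndex a : ℝ) ≤ k := by exact_mod_cast hk
    obtain ⟨hm, hr, hlt⟩ := hc (k + 1 / 2) (hattained _ (by linarith))
    obtain ⟨hm', hr', hlt'⟩ := hc (k + 1) (hattained _ (by linarith))
    have hv := sq_lt_of_mem_Ioo hm
    have hv' := sq_lt_of_mem_Ioo hm'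
    refine ⟨hm.1, hlt _ (by linarith), hlt' _ (by push_cast; linarith),
      ⟨_, _, isOrbitA_stark ha.1 hv hm.1.ne' ?_⟩, ⟨_, _, isOrbitB_stark ha.1 hv' hm'.1.ne' ?_⟩⟩
    · rw [(starkRatio_eq_iff ha.1 hv).1 hr]; ring
    · exact (starkRatio_eq_iff ha.1 hv').1 hr'
  · exact hclim.comp (tendsto_atTop_add_const_right _ _ tendsto_natCast_atTop_atTop)
  · exact hclim.comp (tendsto_atTop_add_const_right _ _ tendsto_natCast_atTop_atTop)
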